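/- Let $\mathbb{K}$ be a field of characteristic zero and $n \geq 3$. Let $\mathrm{GA}_n(\mathbb{K})$ be the group of polynomial automorphisms of $\mathbb{A}^n_{\mathbb{K}}$; each $\phi \in \mathrm{GA}_n(\mathbb{K})$ acts on $\mathbb{K}^{[n]} = \mathbb{K}[x_1,\ldots,x_n]$ on the right as a $\mathbb{K}$-algebra automorphism $P \mapsto (P)\phi$, with $(P)(\phi\psi) = ((P)\phi)\psi$, and is written $\phi = ((x_1)\phi,\ldots,(x_n)\phi)$. An automorphism is affine if all its components have degree one, and triangular if its components are $u_i x_i + P_i$ with $u_i \in \mathbb{K}^*$ and $P_i \in \mathbb{K}[x_1,\ldots,x_{i-1}]$. The tame subgroup $\mathrm{TA}_n(\mathbb{K})$ is generated by the affine and the triangular automorphisms. An automorphism $\phi$ is co-tame if the subgroup generated by $\phi$ and all affine automorphisms contains $\mathrm{TA}_n(\mathbb{K})$. An automorphism is parabolic if it lies in the normalizer in $\mathrm{GA}_n(\mathbb{K})$ of the group of translations $(x_1,\ldots,x_{n-1},x_n+c)$, $c \in \mathbb{K}$, of the last coordinate. A $\mathbb{K}$-derivation $D$ of $\mathbb{K}^{[n]}$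 is locally nilpotent if every polynomial is killed by some power of $D$, and then $\exp(D) \in \mathrm{GA}_n(\mathbb{K})$ is given by $(x_r)\exp(D) = \sum_{i\ge 0} \frac{1}{i!} D^i(x_r)$; $D$ is triangular if $D(x_i) \in \mathbb{K}[x_1,\ldots,x_{i-1}]$ for all $i$. **Theorem.** Let $D$ be a triangular locally nilpotent $\mathbb{K}$-derivation of $\mathbb{K}^{[n]}$ and let $F \in \ker D$. Then for all parabolic automorphisms $\psi_1, \psi_2 \in \mathrm{GA}_n(\mathbb{K})$, the automorphism $\psi_1 \exp(FD)\, \psi_2$ is affine or co-tame. In particular, $\exp(FD)$ is affine or co-tame. This covers the Nagata map: for $n=3$ and $F = x_1x_3 + x_2^2$, the Nagata automorphism $(x_1,\; x_2 + x_1F,\; x_3 - 2x_2F - x_1F^2)$ is of the form $\exp(F'D)$ with $D$ a triangular locally nilpotent derivation and $F' \in \ker D$, and it is co-tame. -/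

import Mathlib

/-! Polynomial automorphisms of affine `n`-space over a field, the affine, triangular, tame and
parabolic automorphisms, co-tame automorphisms, and exponentials of locally nilpotent
derivations. The coordinates `x₁, …, xₙ` are `X 0, …, X (n - 1)`. -/

namespace CoTame

open MvPolynomial

noncomputable section

/-! ### Locally nilpotent derivations and their exponentials -/

section Exponential

variable {K A : Type*} [Field K] [CommRing A] [Algebra K A]

/-- Every element is killed by some power of `D`. -/
def IsLocallyNilpotent (D : Derivation K A A) : Prop :=
  ∀ f : A, ∃ N : ℕ, D^[N] f = 0

/-- `exp(D)(f) = ∑ᵢ Dⁱ(f) / i!`, a finite sum if `D` is locally nilpotent. -/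
def expFun (D : Derivation K A A) (f : A) : A :=
  ∑ᶠ i : ℕ, ((i.factorial : K)⁻¹) • D^[i] f

theorem iterate_zero_of_le {D : Derivation K A A} {f : A} {N M : ℕ} (h : D^[N] f = 0)
    (hNM : N ≤ M) : D^[M] f = 0 := by
  obtain ⟨k, rfl⟩ := Nat.exists_eq_add_of_le hNM
  rw [add_comm, Function.iterate_add_apply, h, iterate_map_zero]

theorem expFun_eq_sum {D : Derivation K A A} {f : A} {N : ℕ} (h : D^[N] f = 0) :
    expFun D f = ∑ i ∈ Finset.range N, ((i.factorial : K)⁻¹) • D^[i] f := by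
  apply finsum_eq_sum_of_support_subset
  intro i hi
  by_contra hlt
  simp only [Finset.coe_range, Set.mem_Iio, not_lt] at hlt
  exact hi (by simp [iterate_zero_of_le h hlt])

theorem sum_square_eq_sum_antidiagonal (b : ℕ → ℕ → A) (N : ℕ)
    (hb : ∀ i j, N ≤ i + j → b i j = 0) :
    ∑ i ∈ Finset.range N, ∑ j ∈ Finset.range N, b i j =
      ∑ k ∈ Finset.range N, ∑ p ∈ Finset.HasAntidiagonal.antidiagonal k, b p.1 p.2 := by
  rw [← Finset.sum_product' (Finset.range N) (Finset.range N) b]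
  have h1 : ∑ p ∈ (Finset.range N ×ˢ Finset.range N).filter (fun p => p.1 + p.2 < N), b p.1 p.2 =
      ∑ p ∈ Finset.range N ×ˢ Finset.range N, b p.1 p.2 := by
    apply Finset.sum_filter_of_ne
    intro p _ hp
    by_contra hlt
    exact hp (hb _ _ (not_lt.1 hlt))
  rw [← h1, ← Finset.sum_fiberwise_of_maps_to (t := Finset.range N) (g := fun p => p.1 + p.2)
    (by intro p hp; simp only [Finset.mem_filter] at hp; simpa using hp.2)]
  refine Finset.sum_congr rfl fun k hk => Finset.sum_congr ?_ fun _ _ => rfl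
  ext p
  simp only [Finset.mem_filter, Finset.mem_product, Finset.mem_range,
    Finset.HasAntidiagonal.mem_antidiagonal] at *
  omega

theorem iterate_mul (D : Derivation K A A) (n : ℕ) (f g : A) :
    D^[n] (f * g) =
      ∑ p ∈ Finset.HasAntidiagonal.antidiagonal n, (n.choose p.1) • (D^[p.1] f * D^[p.2] g) := by
  induction n with
  | zero => simp
  | succ n ih =>
    rw [Finset.sum_antidiagonal_choose_succ_nsmul (fun i j => D^[i] f * D^[j] g) n,
      Function.iterate_succ_apply', ih, map_sum, ← Finset.sum_add_distrib]
    refine Finset.sum_congr rfl fun p hp => ?_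
    rw [n.choose_symm_of_eq_add (Finset.HasAntidiagonal.mem_antidiagonal.1 hp).symm, ← smul_add, map_nsmul,
      Derivation.leibniz, Function.iterate_succ_apply', Function.iterate_succ_apply']
    simp only [smul_eq_mul]
    congr 1
    ring

theorem expFun_add {D : Derivation K A A} (hD : IsLocallyNilpotent D) (f g : A) :
    expFun D (f + g) = expFun D f + expFun D g := by
  obtain ⟨N, hN⟩ := hD f
  obtain ⟨M, hM⟩ := hD g
  have h1 := iterate_zero_of_le hN (Nat.le_add_right N M)
  have h2 := iterate_zero_of_le hM (Nat.le_add_left M N)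
  have h3 : D^[N + M] (f + g) = 0 := by rw [iterate_map_add, h1, h2, add_zero]
  rw [expFun_eq_sum h1, expFun_eq_sum h2, expFun_eq_sum h3, ← Finset.sum_add_distrib]
  simp only [iterate_map_add, smul_add]

theorem expFun_algebraMap (D : Derivation K A A) (c : K) :
    expFun D (algebraMap K A c) = algebraMap K A c := by
  rw [expFun_eq_sum (N := 1) (by simp)]
  simp

theorem expFun_mul [CharZero K] {D : Derivation K A A} (hD : IsLocallyNilpotent D) (f g : A) :
    expFun D (f * g) = expFun D f * expFun D g := by
  obtain ⟨N, hN⟩ := hD f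
  obtain ⟨M, hM⟩ := hD g
  have h1 := iterate_zero_of_le hN (Nat.le_add_right N M)
  have h2 := iterate_zero_of_le hM (Nat.le_add_left M N)
  have hz : ∀ i j, N + M ≤ i + j → D^[i] f * D^[j] g = 0 := by
    intro i j hij
    rcases le_or_gt N i with hi | hi
    · rw [iterate_zero_of_le hN hi, zero_mul]
    · rw [iterate_zero_of_le hM (by omega : M ≤ j), mul_zero]
  have h3 : D^[N + M] (f * g) = 0 := by
    rw [iterate_mul]
    refine Finset.sum_eq_zero fun p hp => ?_
    rw [hz _ _ (Finset.HasAntidiagonal.mem_antidiagonal.1 hp).ge, smul_zero]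
  rw [expFun_eq_sum h1, expFun_eq_sum h2, expFun_eq_sum h3, Finset.sum_mul_sum,
    sum_square_eq_sum_antidiagonal
      (fun i j => ((i.factorial : K)⁻¹ • D^[i] f) * ((j.factorial : K)⁻¹ • D^[j] g))]
  · refine Finset.sum_congr rfl fun k _ => ?_
    rw [iterate_mul, Finset.smul_sum]
    refine Finset.sum_congr rfl fun p hp => ?_
    have hk := Finset.HasAntidiagonal.mem_antidiagonal.1 hp
    subst hk
    rw [← Nat.cast_smul_eq_nsmul K, smul_smul, smul_mul_smul_comm,
      Nat.cast_add_choose]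
    congr 1
    have := Nat.cast_ne_zero (R := K).2 (p.1 + p.2).factorial_ne_zero
    have := Nat.cast_ne_zero (R := K).2 p.1.factorial_ne_zero
    have := Nat.cast_ne_zero (R := K).2 p.2.factorial_ne_zero
    field_simp
  · intro i j hij
    rw [smul_mul_smul_comm, hz i j hij, smul_zero]

theorem iterate_neg (D : Derivation K A A) (i : ℕ) (f : A) :
    (-D)^[i] f = ((-1 : K) ^ i) • D^[i] f := by
  induction i with
  | zero => simp
  | succ i ih =>
    rw [Function.iterate_succ_apply', ih, Function.iterate_succ_apply', pow_succ]
    simp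

theorem IsLocallyNilpotent.neg {D : Derivation K A A} (hD : IsLocallyNilpotent D) :
    IsLocallyNilpotent (-D) := fun f => by
  obtain ⟨N, hN⟩ := hD f
  exact ⟨N, by rw [iterate_neg, hN, smul_zero]⟩

theorem iterate_smul (D : Derivation K A A) (c : K) (i : ℕ) (f : A) :
    D^[i] (c • f) = c • D^[i] f := by
  induction i with
  | zero => simp
  | succ i ih => rw [Function.iterate_succ_apply', ih, Function.iterate_succ_apply', Derivation.map_smul]

theorem iterate_sum (D : Derivation K A A) (s : Finset ℕ) (u : ℕ → A) (i : ℕ) :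
    D^[i] (∑ j ∈ s, u j) = ∑ j ∈ s, D^[i] (u j) := by
  induction i with
  | zero => simp
  | succ i ih => simp only [Function.iterate_succ_apply', ih, map_sum]

theorem expFun_neg_expFun [CharZero K] {D : Derivation K A A} (hD : IsLocallyNilpotent D)
    (f : A) : expFun (-D) (expFun D f) = f := by
  obtain ⟨N, hN⟩ := hD f
  have hN' : D^[N + 1] f = 0 := iterate_zero_of_le hN (Nat.le_succ N)
  have h0 : (-D)^[N + 1] (expFun D f) = 0 := by
    rw [expFun_eq_sum hN', iterate_neg, iterate_sum, Finset.sum_eq_zero, smul_zero]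
    intro j _
    rw [iterate_smul, ← Function.iterate_add_apply, iterate_zero_of_le hN' (by omega), smul_zero]
  rw [expFun_eq_sum h0, expFun_eq_sum hN']
  have h1 : ∀ i, ((i.factorial : K)⁻¹) •
      (-D)^[i] (∑ j ∈ Finset.range (N + 1), ((j.factorial : K)⁻¹) • D^[j] f) =
      ∑ j ∈ Finset.range (N + 1),
        ((i.factorial : K)⁻¹ * (-1) ^ i * (j.factorial : K)⁻¹) • D^[i + j] f := by
    intro i
    rw [iterate_neg, iterate_sum, smul_smul, Finset.smul_sum]
    refine Finset.sum_congr rfl fun j _ => ?_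
    rw [iterate_smul, smul_smul, ← Function.iterate_add_apply]
  simp only [h1]
  rw [sum_square_eq_sum_antidiagonal
    (fun i j => ((i.factorial : K)⁻¹ * (-1) ^ i * (j.factorial : K)⁻¹) • D^[i + j] f)
    (N + 1) (fun i j hij => by rw [iterate_zero_of_le hN' hij, smul_zero])]
  have h2 : ∀ k, ∑ p ∈ Finset.HasAntidiagonal.antidiagonal k,
      ((p.1.factorial : K)⁻¹ * (-1) ^ p.1 * (p.2.factorial : K)⁻¹) • D^[p.1 + p.2] f =
      ((k.factorial : K)⁻¹ * (-1 + 1) ^ k) • D^[k] f := by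
    intro k
    rw [(Commute.all (-1 : K) 1).add_pow', Finset.mul_sum, Finset.sum_smul]
    refine Finset.sum_congr rfl fun p hp => ?_
    have hk := Finset.HasAntidiagonal.mem_antidiagonal.1 hp
    subst hk
    congr 1
    rw [nsmul_eq_mul, Nat.cast_add_choose, one_pow]
    have := Nat.cast_ne_zero (R := K).2 (p.1 + p.2).factorial_ne_zero
    have := Nat.cast_ne_zero (R := K).2 p.1.factorial_ne_zero
    have := Nat.cast_ne_zero (R := K).2 p.2.factorial_ne_zero
    field_simp
  simp only [h2]
  rw [Finset.sum_range_succ', Finset.sum_eq_zero]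
  · simp
  · intro k _
    simp

/-- The exponential `f ↦ ∑ᵢ Dⁱ(f) / i!` of a locally nilpotent derivation, as an algebra
automorphism. -/
def expAlgEquiv [CharZero K] (D : Derivation K A A) (hD : IsLocallyNilpotent D) : A ≃ₐ[K] A where
  toFun := expFun D
  invFun := expFun (-D)
  left_inv := expFun_neg_expFun hD
  right_inv f := by
    have h := expFun_neg_expFun hD.neg f
    rwa [neg_neg] at h
  map_add' := expFun_add hD
  map_mul' := expFun_mul hD
  commutes' := expFun_algebraMap D

theorem iterate_smul_of_mem_ker {D : Derivation K A A} {F : A} (hF : D F = 0) (i : ℕ) (f : A) :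
    (F • D)^[i] f = F ^ i * D^[i] f := by
  induction i with
  | zero => simp
  | succ i ih =>
    rw [Function.iterate_succ_apply', ih, Function.iterate_succ_apply', Derivation.smul_apply,
      Derivation.leibniz, Derivation.leibniz_pow, hF]
    simp only [smul_eq_mul, smul_zero, mul_zero, add_zero, pow_succ]
    ring

theorem IsLocallyNilpotent.smul_of_mem_ker {D : Derivation K A A} (hD : IsLocallyNilpotent D)
    {F : A} (hF : D F = 0) : IsLocallyNilpotent (F • D) := fun f => by
  obtain ⟨N, hN⟩ := hD f
  exact ⟨N, by rw [iterate_smul_of_mem_ker hF, hN, mul_zero]⟩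

end Exponential

/-! ### Polynomial automorphisms of affine space -/

/-- The group `GA_n(K)` of polynomial automorphisms of affine `n`-space over `K`: the opposite of
the group of `K`-algebra automorphisms of `K[x₁, …, xₙ]`. -/
abbrev GA (n : ℕ) (K : Type*) [Field K] : Type _ :=
  (MvPolynomial (Fin n) K ≃ₐ[K] MvPolynomial (Fin n) K)ᵐᵒᵖ

variable {n : ℕ} {K : Type*} [Field K]

/-- `(P)φ`, the image of the polynomial `P` under the algebra automorphism belonging to `φ`. -/
def GA.act (P : MvPolynomial (Fin n) K) (φ : GA n K) : MvPolynomial (Fin n) K :=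
  φ.unop P

theorem GA.act_mul (P : MvPolynomial (Fin n) K) (φ ψ : GA n K) :
    GA.act P (φ * ψ) = GA.act (GA.act P φ) ψ :=
  rfl

/-- The component `(x_i)φ` of `φ`. -/
def GA.component (φ : GA n K) (i : Fin n) : MvPolynomial (Fin n) K :=
  GA.act (X i) φ

theorem GA.ext_component {φ ψ : GA n K} (h : ∀ i, φ.component i = ψ.component i) : φ = ψ := by
  apply MulOpposite.unop_injective
  apply AlgEquiv.coe_toAlgHom_injective
  exact MvPolynomial.algHom_ext h

/-- All components have degree one: membership in `Aff_n(K)`. -/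
def IsAffine (φ : GA n K) : Prop :=
  ∀ i, (φ.component i).totalDegree = 1

/-- `K[x_1, …, x_{i-1}]` inside `K[x_1, …, x_n]`. -/
def lowerPolys (K : Type*) [Field K] (i : Fin n) : Subalgebra K (MvPolynomial (Fin n) K) :=
  MvPolynomial.supported K {j : Fin n | j < i}

/-- `φ = (u₁x₁ + P₁, …, uₙxₙ + Pₙ(x₁, …, x_{n-1}))`: membership in `BA_n(K)`. -/
def IsTriangular (φ : GA n K) : Prop :=
  ∀ i, ∃ u : Kˣ, ∃ P ∈ lowerPolys K i, φ.component i = C (u : K) * X i + P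

/-- The tame subgroup `TA_n(K)`, generated by the affine and the triangular automorphisms. -/
def tameSubgroup (n : ℕ) (K : Type*) [Field K] : Subgroup (GA n K) :=
  Subgroup.closure ({φ | IsAffine φ} ∪ {φ | IsTriangular φ})

/-- `φ` together with the affine automorphisms generates a group containing the tame subgroup. -/
def IsCoTame (φ : GA n K) : Prop :=
  tameSubgroup n K ≤ Subgroup.closure ({φ} ∪ {α | IsAffine α})

/-- The subgroup `Tr_{n,r}(K)` of the translations
`(x_1, …, x_{r-1}, x_r + c, x_{r+1}, …, x_n)` of the `r`-th coordinate. -/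
def translationSubgroup (K : Type*) [Field K] (r : Fin n) : Subgroup (GA n K) where
  carrier := {φ | ∃ c : K, ∀ i, φ.component i = if i = r then X i + C c else X i}
  one_mem' := ⟨0, fun i => by simp [GA.component, GA.act]⟩
  mul_mem' := by
    rintro φ ψ ⟨c, hc⟩ ⟨d, hd⟩
    refine ⟨c + d, fun i => ?_⟩
    have h1 : (φ * ψ).component i = GA.act (φ.component i) ψ := rfl
    have h2 : ψ.unop (X i) = if i = r then X i + C d else X i := hd i
    have h3 : ψ.unop (C c) = C c := ψ.unop.commutes c
    rw [h1, hc i]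
    by_cases hi : i = r
    · simp only [if_pos hi, GA.act, map_add, h3] at h2 ⊢
      rw [h2]
      ring
    · simp only [if_neg hi, GA.act] at h2 ⊢
      exact h2
  inv_mem' := by
    rintro φ ⟨c, hc⟩
    refine ⟨-c, fun i => ?_⟩
    have h1 : φ⁻¹.component i = φ.unop.symm (X i) := rfl
    have h2 : φ.unop (X i) = if i = r then X i + C c else X i := hc i
    have h3 : φ.unop (C c) = C c := φ.unop.commutes c
    rw [h1, AlgEquiv.symm_apply_eq]
    by_cases hi : i = r
    · simp only [if_pos hi, map_add, map_neg, h3] at h2 ⊢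
      rw [h2]
      ring
    · simp only [if_neg hi] at h2 ⊢
      exact h2.symm

/-- The index of the last coordinate `x_n`. -/
def lastIndex (n : ℕ) [NeZero n] : Fin n :=
  ⟨n - 1, Nat.sub_one_lt (NeZero.ne n)⟩

/-- The parabolic subgroup `PA_n(K)`: the normalizer of the group `Tr_{n,n}(K)` of translations of
the last coordinate. -/
def parabolicSubgroup (n : ℕ) [NeZero n] (K : Type*) [Field K] : Subgroup (GA n K) :=
  Subgroup.normalizer (translationSubgroup K (lastIndex n) : Set (GA n K))

/-- A derivation `D` of `K[x₁, …, xₙ]` with `D(x_i) ∈ K[x_1, …, x_{i-1}]` for all `i`. -/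
def IsTriangularDerivation
    (D : Derivation K (MvPolynomial (Fin n) K) (MvPolynomial (Fin n) K)) : Prop :=
  ∀ i, D (X i) ∈ lowerPolys K i

/-- `exp(D) ∈ GA_n(K)`, with components `∑ᵢ Dⁱ(x_r) / i!`. -/
def expGA [CharZero K] (D : Derivation K (MvPolynomial (Fin n) K) (MvPolynomial (Fin n) K))
    (hD : IsLocallyNilpotent D) : GA n K :=
  MulOpposite.op (expAlgEquiv D hD)

/-- The three components of the Nagata map
`(x₁, x₂ + x₁ F, x₃ - 2 x₂ F - x₁ F²)`, where `F = x₁ x₃ + x₂²`. -/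
def nagataComponents (K : Type*) [Field K] : Fin 3 → MvPolynomial (Fin 3) K :=
  let F : MvPolynomial (Fin 3) K := X 0 * X 2 + X 1 ^ 2
  ![X 0, X 1 + X 0 * F, X 2 - 2 * X 1 * F - X 0 * F ^ 2]

end

end CoTame

namespace CoTame

open MvPolynomial

noncomputable section

/-! ### Exponentials -/

section Exponential

variable {K A : Type*} [Field K] [CommRing A] [Algebra K A]

/-! Write φ = ψ₁ exp(FD) ψ₂ and induct on the degree of F in `x_n`. A triangular D commutes with
∂_n, hence with every translation τ of `x_n`, and exponentials of kernel multiples of D compose by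
adding the multipliers. Since ψ₁ and ψ₂ normalize the translations, conjugating a translation by φ
gives, up to a translation, ψ₂⁻¹ exp((F - τF)D) ψ₂ for some τ. Here F - τF is again in ker D and has
lower degree in `x_n`. If one of these conjugates is not affine, the new automorphism is not affine
either; it is co-tame by induction and lies in the group generated by φ and the affine
automorphisms, so φ is co-tame (`isAffine_or_isCoTame_of_commute`).

Otherwise φ conjugates all translations of `x_n` to affine automorphisms, that is, E = φ ∂_n φ⁻¹ has
coefficients of degree at most one. The core is `triangular_mem_of_conj_pderiv_affine`: a non-affine
φ of this kind is co-tame. Its main tool is `expModule`, the vector space of those g in ker E for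
which the generated group contains exp(cgE) for all scalars c. It contains φ(p) for p affine and
free of `x_n`, and affine automorphisms that rescale E preserve it.

If E is constant, a linear change of coordinates makes it a partial derivative, and either some
φ(x_j) or the elementary part of φ gives a non-affine g in the module. Torus weights extract
monomials from g, substitutions produce all the others when n ≥ 3 (`mem_expModule_of_nonaffine`),
and elementary automorphisms generate the triangular ones up to diagonal ones.

If E is not constant, it acts nilpotently on the polynomials of degree at most one, and 1 is in the
image because E has the slice φ(x_n). Splitting off a longest Jordan chain ending at 1 yields
gradings that rescale E. Homogeneous components then supply a non-constant g in the module together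
with a constant vector field that commutes with E and kills g. Some exp(cgE) is not affine but
commutes with that field, which reduces to the constant case. -/

theorem map_expFun {B : Type*} [CommRing B] [Algebra K B] {D : Derivation K A A}
    {D' : Derivation K B B} (hD : IsLocallyNilpotent D) (σ : A →ₗ[K] B)
    (h : ∀ f, σ (D f) = D' (σ f)) (f : A) : σ (expFun D f) = expFun D' (σ f) := by
  have hs : ∀ i, σ (D^[i] f) = D'^[i] (σ f) := fun i =>
    (Function.Semiconj.iterate_right (f := σ) (ga := D) (gb := D') h i) f
  obtain ⟨N, hN⟩ := hD f
  rw [expFun_eq_sum hN, expFun_eq_sum (N := N) (by rw [← hs, hN, map_zero]), map_sum]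
  simp only [map_smul, hs]

theorem expFun_zero (f : A) : expFun (0 : Derivation K A A) f = f := by
  rw [expFun_eq_sum (N := 1) (by simp)]
  simp

theorem expFun_of_iterate_two {D : Derivation K A A} {f : A} (h : D (D f) = 0) :
    expFun D f = f + D f := by
  rw [expFun_eq_sum (N := 2) (by simpa using h)]
  simp [Finset.sum_range_succ]

theorem expFun_smul_of_mem_ker {D : Derivation K A A} {g : A} (hg : D g = 0) {f : A} {N : ℕ}
    (hN : D^[N] f = 0) :
    expFun (g • D) f = ∑ i ∈ Finset.range N, ((i.factorial : K)⁻¹) • (g ^ i * D^[i] f) := by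
  rw [expFun_eq_sum (N := N) (by rw [iterate_smul_of_mem_ker hg, hN, mul_zero])]
  simp only [iterate_smul_of_mem_ker hg]

/-- Displays the exponential as a polynomial in the scalar `c`, the form whose coefficients
`mem_of_forall_sum_pow_smul_mem` extracts. -/
theorem expFun_const_smul {D : Derivation K A A} (c : K) {g : A} (hg : D g = 0) {f : A} {N : ℕ}
    (hN : D^[N] f = 0) :
    expFun ((c • g) • D) f =
      ∑ i ∈ Finset.range N, c ^ i • (((i.factorial : K)⁻¹) • (g ^ i * D^[i] f)) := by
  rw [expFun_smul_of_mem_ker (by simp [hg]) hN]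
  refine Finset.sum_congr rfl fun i _ => ?_
  rw [smul_pow, smul_mul_assoc, smul_comm]

theorem iterate_mul_of_mem_ker {D : Derivation K A A} {g : A} (hg : D g = 0) (i : ℕ) (f : A) :
    D^[i] (g * f) = g * D^[i] f := by
  induction i with
  | zero => simp
  | succ i ih =>
    rw [Function.iterate_succ_apply', ih, Function.iterate_succ_apply', Derivation.leibniz, hg]
    simp

/-- Since `D` kills `g` and `h`, they behave as scalars, and the binomial expansion of `(g + h) ^ k`
gives the usual product formula for exponentials. -/
theorem expFun_add_smul [CharZero K] {D : Derivation K A A} (hD : IsLocallyNilpotent D) {g h : A}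
    (hg : D g = 0) (hh : D h = 0) (f : A) :
    expFun ((g + h) • D) f = expFun (g • D) (expFun (h • D) f) := by
  obtain ⟨N, hN⟩ := hD f
  have h1 : ∀ (s : Finset ℕ) (u : ℕ → A), expFun (g • D) (∑ i ∈ s, u i) =
      ∑ i ∈ s, expFun (g • D) (u i) := fun s u =>
    map_sum (expAlgEquiv (g • D) (hD.smul_of_mem_ker hg)) u s
  have hz : ∀ j, D^[N] (((j.factorial : K)⁻¹) • (h ^ j * D^[j] f)) = 0 := by
    intro j
    rw [iterate_smul, iterate_mul_of_mem_ker (by simp [Derivation.leibniz_pow, hh]),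
      ← Function.iterate_add_apply, iterate_zero_of_le hN (by omega), mul_zero, smul_zero]
  rw [expFun_smul_of_mem_ker (by simp [hg, hh]) hN, expFun_smul_of_mem_ker hh hN, h1]
  have h2 : ∀ j, expFun (g • D) (((j.factorial : K)⁻¹) • (h ^ j * D^[j] f)) =
      ∑ i ∈ Finset.range N, ((i.factorial : K)⁻¹ * (j.factorial : K)⁻¹) •
        (g ^ i * h ^ j * D^[i + j] f) := by
    intro j
    rw [expFun_smul_of_mem_ker hg (hz j)]
    refine Finset.sum_congr rfl fun i _ => ?_
    rw [iterate_smul, iterate_mul_of_mem_ker (by simp [Derivation.leibniz_pow, hh]),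
      ← Function.iterate_add_apply, mul_smul_comm, smul_smul, mul_assoc]
  simp only [h2]
  rw [Finset.sum_comm, sum_square_eq_sum_antidiagonal
    (fun i j => ((i.factorial : K)⁻¹ * (j.factorial : K)⁻¹) • (g ^ i * h ^ j * D^[i + j] f)) N
    (fun i j hij => by rw [iterate_zero_of_le hN hij, mul_zero, smul_zero])]
  refine Finset.sum_congr rfl fun k _ => ?_
  rw [(Commute.all g h).add_pow', Finset.sum_mul, Finset.smul_sum]
  refine Finset.sum_congr rfl fun p hp => ?_
  have hk := Finset.HasAntidiagonal.mem_antidiagonal.1 hp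
  subst hk
  rw [smul_mul_assoc, ← Nat.cast_smul_eq_nsmul K, smul_smul, Nat.cast_add_choose]
  congr 1
  have := Nat.cast_ne_zero (R := K).2 (p.1 + p.2).factorial_ne_zero
  have := Nat.cast_ne_zero (R := K).2 p.1.factorial_ne_zero
  have := Nat.cast_ne_zero (R := K).2 p.2.factorial_ne_zero
  field_simp

/-- The conjugate `σ D σ⁻¹` of a derivation. -/
def conjDer (σ : A ≃ₐ[K] A) (D : Derivation K A A) : Derivation K A A :=
  Derivation.mk' (σ.toLinearMap ∘ₗ (D : A →ₗ[K] A) ∘ₗ σ.symm.toLinearMap) fun a b => by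
    simp

theorem conjDer_apply (σ : A ≃ₐ[K] A) (D : Derivation K A A) (f : A) :
    conjDer σ D f = σ (D (σ.symm f)) := rfl

theorem conjDer_map (σ : A ≃ₐ[K] A) (D : Derivation K A A) (f : A) :
    conjDer σ D (σ f) = σ (D f) := by
  rw [conjDer_apply, σ.symm_apply_apply]

theorem IsLocallyNilpotent.conjDer {D : Derivation K A A} (hD : IsLocallyNilpotent D)
    (σ : A ≃ₐ[K] A) : IsLocallyNilpotent (conjDer σ D) := fun f => by
  obtain ⟨N, hN⟩ := hD (σ.symm f)
  have hs := (Function.Semiconj.iterate_right (f := σ) (ga := D) (gb := CoTame.conjDer σ D)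
    (fun x => (conjDer_map σ D x).symm) N) (σ.symm f)
  rw [hN, map_zero, σ.apply_symm_apply] at hs
  exact ⟨N, hs.symm⟩

theorem conj_expFun {D : Derivation K A A} (hD : IsLocallyNilpotent D) (σ : A ≃ₐ[K] A) (f : A) :
    σ (expFun D (σ.symm f)) = expFun (conjDer σ D) f := by
  have := map_expFun (D' := CoTame.conjDer σ D) hD σ.toLinearMap
    (fun x => (conjDer_map σ D x).symm) (σ.symm f)
  simpa using this

theorem conjDer_smul (σ : A ≃ₐ[K] A) (g : A) (D : Derivation K A A) :
    conjDer σ (g • D) = σ g • conjDer σ D := by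
  ext f
  simp [conjDer_apply]

theorem conjDer_mul (σ τ : A ≃ₐ[K] A) (D : Derivation K A A) :
    conjDer (σ * τ) D = conjDer σ (conjDer τ D) := by
  ext f
  rfl

theorem conjDer_eq_iff {σ : A ≃ₐ[K] A} {D D' : Derivation K A A} :
    conjDer σ D = D' ↔ ∀ f, σ (D f) = D' (σ f) := by
  constructor
  · rintro rfl f
    exact (conjDer_map σ D f).symm
  · intro h
    ext f
    rw [conjDer_apply, h, σ.apply_symm_apply]

end Exponential

/-- A vector outside `W` is detected by a functional that vanishes on `W`; applied to the sum, this
functional gives a polynomial in `c` with infinitely many roots. -/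
theorem mem_of_forall_sum_pow_smul_mem {K V : Type*} [Field K] [Infinite K] [AddCommGroup V]
    [Module K V] (W : Submodule K V) {N : ℕ} {a : ℕ → V}
    (h : ∀ c : K, c ≠ 0 → ∑ i ∈ Finset.range N, c ^ i • a i ∈ W) {i : ℕ} (hi : i < N) :
    a i ∈ W := by
  by_contra hai
  obtain ⟨f, hf, hfW⟩ := Submodule.exists_le_ker_of_notMem hai
  let p : Polynomial K := ∑ i ∈ Finset.range N, Polynomial.C (f (a i)) * Polynomial.X ^ i
  have hp : ∀ c : K, c ≠ 0 → (p.eval c) = 0 := by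
    intro c hc
    have := hfW (h c hc)
    rw [LinearMap.mem_ker, map_sum] at this
    rw [← this]
    simp only [p, Polynomial.eval_finsetSum, Polynomial.eval_mul, Polynomial.eval_C,
      Polynomial.eval_pow, Polynomial.eval_X, map_smul, smul_eq_mul]
    exact Finset.sum_congr rfl fun _ _ => mul_comm _ _
  have hp0 : p = 0 := by
    apply Polynomial.eq_zero_of_infinite_isRoot
    refine Set.Infinite.mono (s := {0}ᶜ) (fun c hc => hp c hc) ?_
    exact (Set.finite_singleton (0 : K)).infinite_compl
  have : p.coeff i = f (a i) := by
    simp [p, Polynomial.coeff_C_mul, Polynomial.coeff_X_pow, hi]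
  rw [hp0, Polynomial.coeff_zero] at this
  exact hf this.symm

/-! ### Splitting off a Jordan block -/

section JordanBlock

variable {K V : Type*} [Field K] [AddCommGroup V] [Module K V]

/-- A longest Jordan chain `w_k ↦ ⋯ ↦ w₁ ↦ w₀ = e ↦ 0` ending in a vector `e` of the kernel of a
nilpotent `N`, with a functional `l` whose translates `l ∘ Nⁱ` are dual to it. -/
structure JordanChain (N : V →ₗ[K] V) (e : V) where
  k : ℕ
  w : ℕ → V
  l : V →ₗ[K] K
  one_le : 1 ≤ k
  w_zero : w 0 = e
  map_w_succ : ∀ j, j < k → N (w (j + 1)) = w j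
  l_pow_w : ∀ i j, j ≤ k → l ((N ^ i) (w j)) = if i = j then 1 else 0
  l_pow_succ : ∀ x, l ((N ^ (k + 1)) x) = 0

/-- Take `k` maximal with `e` in the range of `N ^ k`. Maximality makes `e` independent of the range
of `N ^ (k + 1)` and the higher chain vectors, and a functional separating `e` from their span is
the required `l`. -/
theorem exists_jordanChain {N : V →ₗ[K] V} (hN : IsNilpotent N) {e : V} (he : e ≠ 0)
    (hNe : N e = 0) (her : e ∈ LinearMap.range N) : Nonempty (JordanChain N e) := by
  classical
  have hex : ∃ j, e ∉ LinearMap.range (N ^ j) := by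
    obtain ⟨j, hj⟩ := hN
    refine ⟨j, ?_⟩
    rw [hj]
    rintro ⟨x, hx⟩
    exact he hx.symm
  set j := Nat.find hex with hj
  have hjs : e ∉ LinearMap.range (N ^ j) := Nat.find_spec hex
  have hj2 : 2 ≤ j := by
    by_contra hlt
    have : j = 0 ∨ j = 1 := by omega
    rcases this with h | h <;> rw [h] at hjs
    · exact hjs ⟨e, rfl⟩
    · rw [pow_one] at hjs
      exact hjs her
  obtain ⟨k, hk⟩ : ∃ k, j = k + 1 := ⟨j - 1, by omega⟩
  rw [hk] at hjs
  obtain ⟨v, hv⟩ : e ∈ LinearMap.range (N ^ k) := by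
    by_contra hcon
    have := Nat.find_min' hex hcon
    omega
  have hw : ∀ i j, j ≤ k → (N ^ i) ((N ^ (k - j)) v) =
      if i ≤ j then (N ^ (k - (j - i))) v else 0 := by
    intro i j hjk
    rw [← Module.End.mul_apply, ← pow_add]
    split_ifs with hij
    · congr 2
      omega
    · have : i + (k - j) = (i - j - 1) + 1 + k := by omega
      rw [this, pow_add, Module.End.mul_apply, hv, pow_succ, Module.End.mul_apply, hNe, map_zero]
  set R := LinearMap.range (N ^ (k + 1)) with hR
  have hRst : ∀ i x, x ∈ R → (N ^ i) x ∈ R := by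
    rintro i _ ⟨y, rfl⟩
    refine ⟨(N ^ i) y, ?_⟩
    rw [← Module.End.mul_apply, ← Module.End.mul_apply, ← pow_add, ← pow_add, add_comm]
  have hind : ∀ m, m ≤ k → ∀ a : ℕ → K,
      ∑ j ∈ Finset.range (m + 1), a j • (N ^ (k - j)) v ∈ R → a 0 = 0 := by
    intro m
    induction m with
    | zero =>
      intro _ a ha
      by_contra h0
      rw [zero_add, Finset.sum_range_one, Nat.sub_zero, hv] at ha
      exact hjs ((Submodule.smul_mem_iff _ h0).1 ha)
    | succ m ih =>
      intro hm a ha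
      -- `N ^ (m + 1)` kills every term but the top one, which becomes a multiple of `e`; as `e ∉
      -- R`, the top coefficient is zero.
      have h1 := hRst (m + 1) _ ha
      rw [map_sum, Finset.sum_eq_single (m + 1)] at h1
      · rw [map_smul, hw _ _ hm, if_pos le_rfl, Nat.sub_self, Nat.sub_zero, hv] at h1
        have h0 : a (m + 1) = 0 := by
          by_contra h0
          exact hjs ((Submodule.smul_mem_iff _ h0).1 h1)
        rw [Finset.sum_range_succ, h0, zero_smul, add_zero] at ha
        exact ih (by omega) a ha
      · intro b hb hbm
        have hb' : b < m + 1 + 1 := Finset.mem_range.1 hb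
        rw [map_smul, hw _ _ (by omega), if_neg (by omega), smul_zero]
      · simp
  have heS : e ∉ R ⊔ Submodule.span K (Set.range fun i : Fin k => (N ^ (k - (i.val + 1))) v) := by
    intro hmem
    obtain ⟨r, hr, s, hs, hrs⟩ := Submodule.mem_sup.1 hmem
    obtain ⟨c, rfl⟩ := (Submodule.mem_span_range_iff_exists_fun K).1 hs
    -- The coefficients of `s - e = -r` along the chain: `-1` at `e`, and `c` above it.
    let a : ℕ → K := fun i => if h : 0 < i ∧ i - 1 < k then c ⟨i - 1, h.2⟩ else -1
    have h1 := hind k le_rfl a (by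
      rw [Finset.sum_range_succ', Nat.sub_zero, hv,
        Finset.sum_range (fun i => a (i + 1) • (N ^ (k - (i + 1))) v)]
      have h2 : ∀ i : Fin k, a (i.val + 1) = c i := fun i => by simp [a]
      have h3 : a 0 = -1 := by simp [a]
      simp only [h2, h3]
      have h4 := R.neg_mem hr
      rw [← hrs]
      convert h4 using 1
      module)
    simp [a] at h1
  obtain ⟨f, hf, hfS⟩ := Submodule.exists_le_ker_of_notMem heS
  refine ⟨⟨k, fun j => (N ^ (k - j)) v, (f e)⁻¹ • f, by omega, by rw [Nat.sub_zero, hv], ?_, ?_,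
    ?_⟩⟩
  · intro i hi
    have := hw 1 (i + 1) (by omega)
    rw [pow_one, if_pos (by omega)] at this
    simpa using this
  · intro i m hm
    rw [hw i m hm]
    split_ifs with h1 h2 h3
    · rw [h2, Nat.sub_self, Nat.sub_zero, hv]
      simp [hf]
    · have h4 : (N ^ (k - (m - i))) v ∈
          R ⊔ Submodule.span K (Set.range fun i : Fin k => (N ^ (k - (i.val + 1))) v) := by
        refine Submodule.mem_sup_right (Submodule.subset_span ⟨⟨m - i - 1, by omega⟩, ?_⟩)
        change (N ^ (k - (m - i - 1 + 1))) v = _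
        congr 2
        omega
      have h5 : f ((N ^ (k - (m - i))) v) = 0 := hfS h4
      simp [h5]
    · omega
    · simp
  · intro x
    have h5 : f ((N ^ (k + 1)) x) = 0 := hfS (Submodule.mem_sup_left ⟨x, rfl⟩)
    rw [LinearMap.smul_apply, h5, smul_zero]

namespace JordanChain

variable {N : V →ₗ[K] V} {e : V} (J : JordanChain N e)

/-- The projection onto the line of the `j`-th vector of the chain. -/
def proj (j : ℕ) : V →ₗ[K] V :=
  if j ≤ J.k then (J.l ∘ₗ (N ^ j)).smulRight (J.w j) else 0

theorem proj_apply {j : ℕ} (hj : j ≤ J.k) (x : V) : J.proj j x = J.l ((N ^ j) x) • J.w j := by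
  simp [proj, hj]

theorem proj_w (i : ℕ) {j : ℕ} (hj : j ≤ J.k) :
    J.proj i (J.w j) = if i = j then J.w j else 0 := by
  by_cases hi : i ≤ J.k
  · rw [proj_apply _ hi, J.l_pow_w i j hj]
    split_ifs with h
    · rw [h, one_smul]
    · rw [zero_smul]
  · rw [proj, if_neg hi, if_neg (by omega), LinearMap.zero_apply]

theorem map_w_zero (hNe : N e = 0) : N (J.w 0) = 0 := by rw [J.w_zero, hNe]

theorem map_proj_zero (hNe : N e = 0) (x : V) : N (J.proj 0 x) = 0 := by
  rw [proj_apply _ (Nat.zero_le _), map_smul, J.map_w_zero hNe, smul_zero]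

/-- At `j = J.k` both sides vanish: the left by the truncation in `proj`, the right because `J.l`
kills the range of `N ^ (J.k + 1)`. -/
theorem map_proj_succ (j : ℕ) (x : V) : N (J.proj (j + 1) x) = J.proj j (N x) := by
  have hx : (N ^ j) (N x) = (N ^ (j + 1)) x := by rw [pow_succ, Module.End.mul_apply]
  rcases lt_trichotomy j J.k with h | h | h
  · rw [proj_apply _ h, proj_apply _ h.le, map_smul, J.map_w_succ j h, hx]
  · rw [proj, if_neg (by omega), proj_apply _ h.le, hx, h, J.l_pow_succ]
    simp
  · rw [proj, if_neg (by omega), proj, if_neg (by omega)]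
    simp

/-- The projection onto the invariant complement of the chain. -/
def compl : V →ₗ[K] V :=
  LinearMap.id - ∑ j ∈ Finset.range (J.k + 1), J.proj j

theorem compl_apply (x : V) : J.compl x = x - ∑ j ∈ Finset.range (J.k + 1), J.proj j x := by
  simp [compl]

theorem compl_w {j : ℕ} (hj : j ≤ J.k) : J.compl (J.w j) = 0 := by
  rw [compl_apply]
  simp only [J.proj_w _ hj]
  rw [Finset.sum_ite_eq' (Finset.range (J.k + 1)) j, if_pos (Finset.mem_range.2 (by omega)),
    sub_self]

theorem compl_proj (j : ℕ) (x : V) : J.compl (J.proj j x) = 0 := by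
  by_cases hj : j ≤ J.k
  · rw [J.proj_apply hj, map_smul, J.compl_w hj, smul_zero]
  · simp [proj, hj]

theorem compl_compl (x : V) : J.compl (J.compl x) = J.compl x := by
  conv_lhs => rw [J.compl_apply x]
  rw [map_sub, map_sum, Finset.sum_eq_zero fun j _ => J.compl_proj j x, sub_zero]

theorem map_compl (hNe : N e = 0) (x : V) : N (J.compl x) = J.compl (N x) := by
  rw [compl_apply, compl_apply, map_sub, map_sum, Finset.sum_range_succ', J.map_proj_zero hNe,
    add_zero, Finset.sum_range_succ _ J.k]
  simp only [map_proj_succ]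
  have : J.proj J.k (N x) = 0 := by
    rw [← map_proj_succ, proj, if_neg (by omega)]
    simp
  rw [this, add_zero]

theorem pow_map_compl (hNe : N e = 0) (i : ℕ) (x : V) :
    (N ^ i) (J.compl x) = J.compl ((N ^ i) x) := by
  induction i with
  | zero => rfl
  | succ i ih => rw [pow_succ', Module.End.mul_apply, ih, J.map_compl hNe, Module.End.mul_apply]

/-- A functional on the complement that vanishes on the image of `N`. -/
theorem exists_functional (hN : IsNilpotent N) (hNe : N e = 0) (h : J.compl ≠ 0) :
    ∃ ζ : V →ₗ[K] K, ζ ≠ 0 ∧ (∀ x, ζ (N x) = 0) ∧ ∀ x, ζ (J.compl x) = ζ x := by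
  -- If `J.compl ∘ N` filled the complement, iterating would write its vectors as images under
  -- arbitrarily high powers of `N`, so the complement would be zero.
  obtain ⟨x, hx⟩ : ∃ x, J.compl x ∉ LinearMap.range (J.compl ∘ₗ N) := by
    by_contra hcon
    push Not at hcon
    have h1 : ∀ i x, ∃ y, J.compl x = J.compl ((N ^ i) y) := by
      intro i
      induction i with
      | zero => exact fun x => ⟨x, rfl⟩
      | succ i ih =>
        intro x
        obtain ⟨y, hy⟩ := ih x
        obtain ⟨z, hz⟩ := hcon y
        refine ⟨z, ?_⟩
        rw [hy, ← J.pow_map_compl hNe, ← hz, pow_succ, Module.End.mul_apply,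
          LinearMap.comp_apply, J.pow_map_compl hNe]
    obtain ⟨m, hm⟩ := hN
    refine h (LinearMap.ext fun x => ?_)
    obtain ⟨y, hy⟩ := h1 m x
    rw [hy, hm]
    simp
  obtain ⟨f, hf, hfS⟩ := Submodule.exists_le_ker_of_notMem hx
  refine ⟨f ∘ₗ J.compl, fun hz => hf (LinearMap.congr_fun hz x), fun y => hfS ⟨y, rfl⟩,
    fun y => ?_⟩
  rw [LinearMap.comp_apply, LinearMap.comp_apply, J.compl_compl]

/-- If the chain has length two and `N` is not a multiple of its restriction to the chain, then
the complement has a nonzero element in the kernel and in the image of `N`. -/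
theorem exists_mem_ker (hN : IsNilpotent N) (hNe : N e = 0) (hk : J.k = 1) {x : V}
    (hx : ∀ c : K, N x ≠ c • e) : ∃ y, J.compl (N y) ≠ 0 ∧ N (J.compl (N y)) = 0 := by
  classical
  have h1 : N (J.compl x) ≠ 0 := by
    intro h0
    rw [J.compl_apply, hk, Finset.sum_range_succ, Finset.sum_range_one, map_sub, map_add,
      J.map_proj_zero hNe, zero_add, J.map_proj_succ, J.proj_apply (Nat.zero_le _), J.w_zero,
      sub_eq_zero] at h0
    exact hx _ h0
  -- The goal is the last nonzero iterate of `J.compl x`; by `h1` its exponent is at least one, so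
  -- it lies in the image of `N`.
  have hex : ∃ m, (N ^ (m + 1)) (J.compl x) = 0 := by
    obtain ⟨m, hm⟩ := hN
    exact ⟨m, by rw [pow_succ, hm]; simp⟩
  have hs := Nat.find_spec hex
  obtain ⟨m, hm⟩ : ∃ m, Nat.find hex = m + 1 := by
    refine ⟨Nat.find hex - 1, ?_⟩
    have : Nat.find hex ≠ 0 := by
      intro h0
      rw [h0] at hs
      exact h1 (by simpa using hs)
    omega
  have hmin := Nat.find_min hex (m := m) (by omega)
  rw [hm] at hs
  refine ⟨(N ^ m) x, ?_, ?_⟩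
  · rwa [← Module.End.mul_apply N (N ^ m), ← pow_succ', ← J.pow_map_compl hNe]
  · rwa [← Module.End.mul_apply N (N ^ m), ← pow_succ', ← J.pow_map_compl hNe,
      ← Module.End.mul_apply, ← pow_succ']

theorem finrank_le_of_compl_eq_zero (h : J.compl = 0) : Module.finrank K V ≤ J.k + 1 := by
  have hspan : Submodule.span K (Set.range fun i : Fin (J.k + 1) => J.w i) = ⊤ := by
    rw [eq_top_iff]
    intro x _
    have h1 : J.compl x = 0 := by rw [h]; rfl
    rw [J.compl_apply, sub_eq_zero] at h1
    rw [h1]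
    refine Submodule.sum_mem _ fun j hj => ?_
    have hj' := Finset.mem_range.1 hj
    rw [J.proj_apply (by omega)]
    exact Submodule.smul_mem _ _ (Submodule.subset_span ⟨⟨j, hj'⟩, rfl⟩)
  have := finrank_range_le_card (R := K) (fun i : Fin (J.k + 1) => J.w i)
  rw [Set.finrank, hspan, finrank_top, Fintype.card_fin] at this
  exact this

end JordanChain

end JordanBlock

variable {n : ℕ} {K : Type*} [Field K]

/-! ### Polynomials of degree at most one and affine automorphisms -/

theorem isLocallyNilpotent_of_X [CharZero K]
    {D : Derivation K (MvPolynomial (Fin n) K) (MvPolynomial (Fin n) K)}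
    (h : ∀ i, ∃ N, D^[N] (X i) = 0) : IsLocallyNilpotent D := by
  intro f
  induction f using MvPolynomial.induction_on with
  | C a => exact ⟨1, by simp⟩
  | add p q hp hq =>
    obtain ⟨N, hN⟩ := hp
    obtain ⟨M, hM⟩ := hq
    refine ⟨N + M, ?_⟩
    rw [iterate_map_add, iterate_zero_of_le hN (by omega), iterate_zero_of_le hM (by omega),
      add_zero]
  | mul_X p i hp =>
    obtain ⟨N, hN⟩ := hp
    obtain ⟨M, hM⟩ := h i
    refine ⟨N + M, ?_⟩
    rw [iterate_mul]
    refine Finset.sum_eq_zero fun x hx => ?_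
    have hk := Finset.HasAntidiagonal.mem_antidiagonal.1 hx
    rcases le_or_gt N x.1 with hi | hi
    · rw [iterate_zero_of_le hN hi, zero_mul, smul_zero]
    · rw [iterate_zero_of_le hM (by omega : M ≤ x.2), mul_zero, smul_zero]

theorem isLocallyNilpotent_pderiv [CharZero K] (j : Fin n) :
    IsLocallyNilpotent (pderiv (R := K) j) :=
  isLocallyNilpotent_of_X fun i => ⟨2, by
    by_cases h : i = j
    · subst h; simp
    · simp [pderiv_X_of_ne h]⟩

/-- The polynomials of degree at most one. -/
abbrev affinePolys (n : ℕ) (K : Type*) [Field K] : Submodule K (MvPolynomial (Fin n) K) :=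
  restrictTotalDegree (Fin n) K 1

theorem mem_affinePolys {p : MvPolynomial (Fin n) K} :
    p ∈ affinePolys n K ↔ p.totalDegree ≤ 1 :=
  mem_restrictTotalDegree _ _ _

theorem X_mem_affinePolys (i : Fin n) : (X i : MvPolynomial (Fin n) K) ∈ affinePolys n K :=
  mem_affinePolys.2 (totalDegree_X i).le

theorem C_mem_affinePolys (c : K) : (C c : MvPolynomial (Fin n) K) ∈ affinePolys n K :=
  mem_affinePolys.2 (by simp)

theorem one_mem_affinePolys : (1 : MvPolynomial (Fin n) K) ∈ affinePolys n K := by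
  simpa using C_mem_affinePolys (n := n) (1 : K)

theorem eq_of_mem_affinePolys {p : MvPolynomial (Fin n) K} (hp : p ∈ affinePolys n K) :
    p = C (p.coeff 0) + ∑ i, p.coeff (Finsupp.single i 1) • X i := by
  classical
  rw [mem_affinePolys] at hp
  ext m
  rcases Nat.lt_or_ge 1 m.degree with hm | hm
  · rw [coeff_eq_zero_of_totalDegree_lt (by
      have : m.degree = ∑ i ∈ m.support, m i := rfl
      omega)]
    have h0 : m ≠ 0 := by rintro rfl; simp at hm
    have h1 : ∀ i, Finsupp.single i 1 ≠ m := by rintro i rfl; simp at hm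
    simp [coeff_C, h0.symm, coeff_sum, coeff_X, h1]
  · by_cases h0 : m = 0
    · subst h0
      simp [coeff_sum, coeff_X]
    · have h1 : m.degree = 1 := by
        have : m.degree ≠ 0 := by rwa [ne_eq, Finsupp.degree_eq_zero_iff]
        omega
      obtain ⟨i, rfl⟩ := (Finsupp.sum_eq_one_iff m).1 h1
      rw [coeff_add, coeff_C, if_neg (Ne.symm h0), coeff_sum, Finset.sum_eq_single i]
      · simp
      · intro j _ hj
        simp [coeff_X, Finsupp.single_left_inj, hj]
      · simp

theorem affinePolys_decomposition (p : affinePolys n K) :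
    p = (coeff 0 (p : MvPolynomial (Fin n) K)) • ⟨1, one_mem_affinePolys⟩ +
      ∑ i, (coeff (Finsupp.single i 1) (p : MvPolynomial (Fin n) K)) •
        (⟨X i, X_mem_affinePolys i⟩ : affinePolys n K) := by
  apply Subtype.ext
  conv_lhs => rw [eq_of_mem_affinePolys p.2]
  simp [C_eq_smul_one]

theorem affinePolys_hom_ext {V : Type*} [AddCommGroup V] [Module K V]
    {f g : affinePolys n K →ₗ[K] V}
    (h1 : f ⟨1, one_mem_affinePolys⟩ = g ⟨1, one_mem_affinePolys⟩)
    (hX : ∀ i, f ⟨X i, X_mem_affinePolys i⟩ = g ⟨X i, X_mem_affinePolys i⟩) : f = g := by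
  ext p
  rw [affinePolys_decomposition p]
  simp only [map_add, map_sum, map_smul, h1, hX]

theorem lt_finrank_affinePolys : n < Module.finrank K (affinePolys n K) := by
  have h : LinearIndependent K (fun o : Option (Fin n) =>
      o.elim (⟨1, one_mem_affinePolys⟩ : affinePolys n K) fun i => ⟨X i, X_mem_affinePolys i⟩) := by
    classical
    rw [Fintype.linearIndependent_iff]
    intro a ha
    rw [Fintype.sum_option] at ha
    have h1 : C (a none) + ∑ i, a (some i) • (X i : MvPolynomial (Fin n) K) = 0 := by
      simpa [C_eq_smul_one] using congrArg Subtype.val ha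
    rintro (_ | i)
    · simpa [coeff_sum, coeff_X] using congrArg (coeff 0) h1
    · have h2 := congrArg (coeff (Finsupp.single i 1)) h1
      rw [coeff_add, coeff_sum, Finset.sum_eq_single i] at h2
      · have h0 : (0 : Fin n →₀ ℕ) ≠ Finsupp.single i 1 :=
          (Finsupp.single_ne_zero.2 one_ne_zero).symm
        simpa [coeff_C, h0] using h2
      · intro j _ hj
        simp [coeff_X, Finsupp.single_left_inj, hj]
      · simp
  have := h.fintype_card_le_finrank
  simpa using this

theorem affinePolys_le_of_X {W : Submodule K (MvPolynomial (Fin n) K)} (h1 : 1 ∈ W)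
    (hX : ∀ i, X i ∈ W) : affinePolys n K ≤ W := by
  intro p hp
  rw [eq_of_mem_affinePolys hp]
  refine W.add_mem ?_ (W.sum_mem fun i _ => W.smul_mem _ (hX i))
  rw [C_eq_smul_one]
  exact W.smul_mem _ h1

theorem map_affinePolys_le {V : Type*} [AddCommGroup V] [Module K V] {W : Submodule K V}
    {f : MvPolynomial (Fin n) K →ₗ[K] V} (h1 : f 1 ∈ W) (hX : ∀ i, f (X i) ∈ W)
    {p : MvPolynomial (Fin n) K} (hp : p ∈ affinePolys n K) : f p ∈ W :=
  affinePolys_le_of_X (W := W.comap f) h1 hX hp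

theorem eqOn_affinePolys {V : Type*} [AddCommGroup V] [Module K V]
    {f g : MvPolynomial (Fin n) K →ₗ[K] V} (h1 : f 1 = g 1) (hX : ∀ i, f (X i) = g (X i))
    {p : MvPolynomial (Fin n) K} (hp : p ∈ affinePolys n K) : f p = g p :=
  affinePolys_le_of_X (W := LinearMap.eqLocus f g) h1 hX hp

theorem mul_notMem_affinePolys {p q : MvPolynomial (Fin n) K} (hp : p.totalDegree ≠ 0)
    (hq : q.totalDegree ≠ 0) : p * q ∉ affinePolys n K := by
  rw [mem_affinePolys, totalDegree_mul_of_isDomain (by rintro rfl; simp at hp)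
    (by rintro rfl; simp at hq)]
  omega

/-- All `σ(x_i)` have degree at most one. -/
def IsAffineEquiv (σ : MvPolynomial (Fin n) K ≃ₐ[K] MvPolynomial (Fin n) K) : Prop :=
  ∀ i, σ (X i) ∈ affinePolys n K

theorem IsAffineEquiv.map_mem {σ : MvPolynomial (Fin n) K ≃ₐ[K] MvPolynomial (Fin n) K}
    (h : IsAffineEquiv σ) {p : MvPolynomial (Fin n) K} (hp : p ∈ affinePolys n K) :
    σ p ∈ affinePolys n K :=
  map_affinePolys_le (f := σ.toLinearMap) (by simpa using one_mem_affinePolys) h hp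

theorem IsAffineEquiv.mul {σ τ : MvPolynomial (Fin n) K ≃ₐ[K] MvPolynomial (Fin n) K}
    (hσ : IsAffineEquiv σ) (hτ : IsAffineEquiv τ) : IsAffineEquiv (σ * τ) :=
  fun i => hσ.map_mem (hτ i)

/-- An injective endomorphism of the finite-dimensional space of affine polynomials is surjective.
-/
theorem IsAffineEquiv.symm_map_mem {σ : MvPolynomial (Fin n) K ≃ₐ[K] MvPolynomial (Fin n) K}
    (h : IsAffineEquiv σ) {p : MvPolynomial (Fin n) K} (hp : p ∈ affinePolys n K) :
    σ.symm p ∈ affinePolys n K := by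
  let f : affinePolys n K →ₗ[K] affinePolys n K :=
    σ.toLinearMap.restrict (fun _ hp => h.map_mem hp)
  have hf : Function.Injective f := by
    intro a b hab
    exact Subtype.ext (σ.injective (congrArg Subtype.val hab))
  obtain ⟨q, hq⟩ := LinearMap.injective_iff_surjective.1 hf ⟨p, hp⟩
  have : σ q = p := congrArg Subtype.val hq
  rw [← this, σ.symm_apply_apply]
  exact q.2

theorem IsAffineEquiv.inv {σ : MvPolynomial (Fin n) K ≃ₐ[K] MvPolynomial (Fin n) K}
    (h : IsAffineEquiv σ) : IsAffineEquiv σ⁻¹ :=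
  fun i => h.symm_map_mem (X_mem_affinePolys i)

theorem totalDegree_eq_zero_of_map {σ : MvPolynomial (Fin n) K ≃ₐ[K] MvPolynomial (Fin n) K}
    {p : MvPolynomial (Fin n) K} (h : (σ p).totalDegree = 0) : p.totalDegree = 0 := by
  rw [totalDegree_eq_zero_iff_eq_C] at h
  have : p = C (coeff 0 (σ p)) := by
    apply σ.injective
    rw [h]
    simpa using (σ.commutes (coeff 0 (σ p))).symm
  rw [this, totalDegree_C]

theorem isAffine_iff (φ : GA n K) : IsAffine φ ↔ IsAffineEquiv φ.unop := by
  refine forall_congr' fun i => ?_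
  rw [mem_affinePolys]
  refine ⟨fun h => h.le, fun h => ?_⟩
  have h0 : (φ.unop (X i)).totalDegree ≠ 0 := by
    intro h0
    simpa using totalDegree_eq_zero_of_map h0
  change (φ.unop (X i)).totalDegree = 1
  omega

/-- A linear automorphism of the space of polynomials of degree at most one that fixes `1`
extends to an affine automorphism. -/
theorem exists_affineEquiv (e : affinePolys n K ≃ₗ[K] affinePolys n K)
    (h1 : (e ⟨1, one_mem_affinePolys⟩ : MvPolynomial (Fin n) K) = 1) :
    ∃ σ : MvPolynomial (Fin n) K ≃ₐ[K] MvPolynomial (Fin n) K, IsAffineEquiv σ ∧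
      ∀ p : affinePolys n K, σ p = e p := by
  have key : ∀ e : affinePolys n K ≃ₗ[K] affinePolys n K,
      (e ⟨1, one_mem_affinePolys⟩ : MvPolynomial (Fin n) K) = 1 →
      ∀ p : affinePolys n K,
        aeval (fun i => (e ⟨X i, X_mem_affinePolys i⟩ : MvPolynomial (Fin n) K))
          (p : MvPolynomial (Fin n) K) = e p := by
    intro e h1 p
    conv_lhs => rw [eq_of_mem_affinePolys p.2]
    conv_rhs => rw [affinePolys_decomposition p]
    rw [map_add e, map_sum e, map_smul e]
    simp only [map_smul e, Submodule.coe_add, Submodule.coe_smul, h1, Submodule.coe_sum, map_add,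
      map_sum, map_smul, aeval_X, algHom_C, Algebra.algebraMap_eq_smul_one]
  have h1' : (e.symm ⟨1, one_mem_affinePolys⟩ : MvPolynomial (Fin n) K) = 1 := by
    have : e ⟨1, one_mem_affinePolys⟩ = ⟨1, one_mem_affinePolys⟩ := Subtype.ext h1
    rw [e.symm_apply_eq.2 this.symm]
  have hinv : ∀ e : affinePolys n K ≃ₗ[K] affinePolys n K,
      (e ⟨1, one_mem_affinePolys⟩ : MvPolynomial (Fin n) K) = 1 →
      (aeval (fun i => (e ⟨X i, X_mem_affinePolys i⟩ : MvPolynomial (Fin n) K))).comp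
        (aeval (fun i => (e.symm ⟨X i, X_mem_affinePolys i⟩ : MvPolynomial (Fin n) K))) =
      AlgHom.id K _ := by
    intro e h1
    apply MvPolynomial.algHom_ext
    intro i
    rw [AlgHom.comp_apply, aeval_X, key e h1, LinearEquiv.apply_symm_apply, AlgHom.id_apply]
  refine ⟨AlgEquiv.ofAlgHom _ _ (hinv e h1) (by simpa using hinv e.symm h1'), fun i => ?_,
    key e h1⟩
  change aeval _ (X i) ∈ _
  rw [aeval_X]
  exact (e _).2

theorem exists_affineEquiv_of_injOn (f : MvPolynomial (Fin n) K →ₐ[K] MvPolynomial (Fin n) K)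
    (hf : ∀ i, f (X i) ∈ affinePolys n K) (hinj : ∀ p ∈ affinePolys n K, f p = 0 → p = 0) :
    ∃ σ : MvPolynomial (Fin n) K ≃ₐ[K] MvPolynomial (Fin n) K, IsAffineEquiv σ ∧
      ∀ p, σ p = f p := by
  let g : affinePolys n K →ₗ[K] affinePolys n K := f.toLinearMap.restrict (fun _ hp =>
    map_affinePolys_le (f := f.toLinearMap) (by simpa using one_mem_affinePolys) hf hp)
  have hg : Function.Injective g := by
    rw [injective_iff_map_eq_zero]
    intro a ha
    exact Subtype.ext (hinj a a.2 (congrArg Subtype.val ha))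
  obtain ⟨σ, hσ, h⟩ := exists_affineEquiv (LinearEquiv.ofInjectiveEndo g hg) (by
    change f 1 = 1
    exact map_one f)
  refine ⟨σ, hσ, fun p => ?_⟩
  have : (σ : MvPolynomial (Fin n) K →ₐ[K] MvPolynomial (Fin n) K) = f :=
    MvPolynomial.algHom_ext fun i => h ⟨X i, X_mem_affinePolys i⟩
  exact DFunLike.congr_fun this p

/-! ### Derivations with constant coefficients -/

/-- The directional derivative `∑ᵢ uᵢ ∂ᵢ`. -/
def constDer (u : Fin n → K) :
    Derivation K (MvPolynomial (Fin n) K) (MvPolynomial (Fin n) K) :=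
  mkDerivation K fun i => C (u i)

theorem constDer_X (u : Fin n → K) (i : Fin n) : constDer u (X i) = C (u i) :=
  mkDerivation_X _ _ _

/-- Every nonzero directional derivative is conjugate to a partial derivative by a linear
automorphism. -/
theorem exists_affineEquiv_conj_pderiv (l : Fin n) {u : Fin n → K} (hu : u ≠ 0) :
    ∃ β : MvPolynomial (Fin n) K ≃ₐ[K] MvPolynomial (Fin n) K, IsAffineEquiv β ∧
      conjDer β (pderiv l) = constDer u := by
  classical
  obtain ⟨j, hj⟩ := Function.ne_iff.1 hu
  rw [Pi.zero_apply] at hj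
  -- `y` is a linear coordinate system in which `constDer u` becomes differentiation by the `l`-th
  -- coordinate, and `z` is its inverse; the swap moves the pivot `j`, where `u j ≠ 0`, to position
  -- `l`.
  let s := Equiv.swap j l
  let y : Fin n → MvPolynomial (Fin n) K := fun i =>
    if i = l then (u j)⁻¹ • X j else X (s i) - (u (s i) * (u j)⁻¹) • X j
  let z : Fin n → MvPolynomial (Fin n) K := fun i =>
    if i = j then u j • X l else X (s i) + u i • X l
  have hs : ∀ i, s (s i) = i := fun i => Equiv.swap_apply_self j l i
  have hsl : ∀ i, s i = l ↔ i = j := fun i => by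
    rw [← Equiv.swap_apply_left j l]
    exact s.injective.eq_iff
  have hsj : ∀ i, s i = j ↔ i = l := fun i => by
    rw [← Equiv.swap_apply_right j l]
    exact s.injective.eq_iff
  have h1 : (aeval y).comp (aeval z) = AlgHom.id K _ := by
    apply MvPolynomial.algHom_ext
    intro i
    by_cases hi : i = j
    · simp [z, y, hi, smul_smul, hj]
    · have : s i ≠ l := by rwa [ne_eq, hsl]
      simp [z, y, hi, this, hs, smul_smul]
  have h2 : (aeval z).comp (aeval y) = AlgHom.id K _ := by
    apply MvPolynomial.algHom_ext
    intro i
    by_cases hi : i = l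
    · simp [z, y, hi, smul_smul, hj]
    · have : s i ≠ j := by rwa [ne_eq, hsj]
      simp [z, y, hi, this, hs, smul_smul, hj]
  let β : MvPolynomial (Fin n) K ≃ₐ[K] MvPolynomial (Fin n) K := AlgEquiv.ofAlgHom _ _ h1 h2
  have hβ : ∀ i, β (X i) = y i := fun i => aeval_X y i
  refine ⟨β, fun i => ?_, ?_⟩
  · rw [hβ]
    by_cases hi : i = l
    · simp only [y, if_pos hi]
      exact Submodule.smul_mem _ _ (X_mem_affinePolys _)
    · simp only [y, if_neg hi]
      exact Submodule.sub_mem _ (X_mem_affinePolys _)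
        (Submodule.smul_mem _ _ (X_mem_affinePolys _))
  · have : conjDer β.symm (constDer u) = pderiv l := by
      apply derivation_ext
      intro i
      rw [conjDer_apply, β.symm_symm, hβ]
      by_cases hi : i = l
      · simp only [y, if_pos hi]
        rw [Derivation.map_smul, constDer_X, smul_eq_C_mul, ← C_mul, inv_mul_cancel₀ hj, hi]
        simp
      · rw [pderiv_X_of_ne hi]
        simp only [y, if_neg hi]
        rw [Derivation.map_sub, Derivation.map_smul, constDer_X, constDer_X, smul_eq_C_mul,
          ← C_mul, mul_assoc, inv_mul_cancel₀ hj, mul_one, sub_self, map_zero]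
    rw [← this]
    ext f
    simp [conjDer_apply]

theorem mem_supported_of_pderiv_eq_zero [CharZero K] {l : Fin n} {f : MvPolynomial (Fin n) K}
    (hf : pderiv l f = 0) : f ∈ supported K {j : Fin n | j ≠ l} := by
  rw [mem_supported]
  intro j hj hjl
  simp only [Finset.mem_coe, mem_vars_iff_mem_support] at hj
  obtain ⟨m, hm, hjm⟩ := hj
  rw [hjl, Finsupp.mem_support_iff] at hjm
  have h := congrArg (coeff (m - Finsupp.single l 1)) hf
  rw [coeff_pderiv, tsub_add_cancel_of_le (by simpa using Nat.one_le_iff_ne_zero.2 hjm),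
    coeff_zero] at h
  refine (mul_ne_zero (mem_support_iff.1 hm) ?_) h
  norm_cast

/-! ### Exponentials inside a group of automorphisms -/

section ExpModule

variable {A : Type*} [CommRing A] [Algebra K A]

/-- The elements `g` of the kernel of `D` such that `H` contains `exp(c g D)` for all scalars
`c`. -/
def expModule [CharZero K] (H : Subgroup (A ≃ₐ[K] A)) {D : Derivation K A A}
    (hD : IsLocallyNilpotent D) : Submodule K A where
  carrier := {g | D g = 0 ∧ ∀ c : K, ∃ σ ∈ H, ∀ f, σ f = expFun ((c • g) • D) f}
  zero_mem' := ⟨map_zero D, fun c => ⟨1, H.one_mem, fun f => by simp [expFun_zero]⟩⟩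
  add_mem' := by
    rintro g h ⟨hg, hg'⟩ ⟨hh, hh'⟩
    refine ⟨by simp [hg, hh], fun c => ?_⟩
    obtain ⟨σ, hσ, hσ'⟩ := hg' c
    obtain ⟨τ, hτ, hτ'⟩ := hh' c
    refine ⟨σ * τ, H.mul_mem hσ hτ, fun f => ?_⟩
    rw [smul_add, expFun_add_smul hD (by simp [hg]) (by simp [hh]), AlgEquiv.mul_apply, hτ', hσ']
  smul_mem' := by
    rintro c g ⟨hg, hg'⟩
    refine ⟨by simp [hg], fun d => ?_⟩
    obtain ⟨σ, hσ, hσ'⟩ := hg' (d * c)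
    exact ⟨σ, hσ, fun f => by rw [hσ', smul_smul]⟩

theorem expAlgEquiv_mem [CharZero K] {H : Subgroup (A ≃ₐ[K] A)} {D : Derivation K A A}
    {hD : IsLocallyNilpotent D} {g : A} (hg : g ∈ expModule H hD)
    (h : IsLocallyNilpotent (g • D)) : expAlgEquiv (g • D) h ∈ H := by
  obtain ⟨σ, hσ, hσ'⟩ := hg.2 1
  convert hσ
  ext f
  rw [hσ', one_smul]
  rfl

/-- Conjugation by `σ` takes the exponential of `c g D` to that of `c t σ(g) D'`; the factor `t` is
absorbed into the freely varying scalar. -/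
theorem conj_mem_expModule [CharZero K] {H : Subgroup (A ≃ₐ[K] A)} {D D' : Derivation K A A}
    {hD : IsLocallyNilpotent D} {hD' : IsLocallyNilpotent D'} {σ : A ≃ₐ[K] A} (hσ : σ ∈ H) {t : K}
    (ht : t ≠ 0) (h : conjDer σ D = t • D') {g : A} (hg : g ∈ expModule H hD) :
    σ g ∈ expModule H hD' := by
  refine ⟨?_, fun c => ?_⟩
  · have h1 := conjDer_map σ D g
    rw [h, hg.1, map_zero, Derivation.smul_apply] at h1
    exact (smul_eq_zero.1 h1).resolve_left ht
  · obtain ⟨τ, hτ, hτ'⟩ := hg.2 (c * t⁻¹)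
    refine ⟨σ * τ * σ⁻¹, H.mul_mem (H.mul_mem hσ hτ) (H.inv_mem hσ), fun f => ?_⟩
    have h2 : (c • σ g) • D' = conjDer σ (((c * t⁻¹) • g) • D) := by
      rw [conjDer_smul, h, map_smul]
      ext x
      simp only [Derivation.smul_apply, smul_eq_mul, smul_mul_assoc, mul_smul_comm, smul_smul]
      rw [mul_left_comm, mul_inv_cancel₀ ht, mul_one]
    rw [h2, ← conj_expFun (hD.smul_of_mem_ker (by simp [hg.1]))]
    change σ (τ (σ.symm f)) = _
    rw [hτ']

end ExpModule

/-! ### A non-affine elementary automorphism generates the tame group -/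

theorem expFun_smul_pderiv {i : Fin n} {P f : MvPolynomial (Fin n) K} (hP : pderiv i P = 0)
    (hf : pderiv i (pderiv i f) = 0) :
    expFun (P • pderiv (R := K) i) f = f + P * pderiv i f := by
  rw [expFun_of_iterate_two] <;> simp [Derivation.leibniz, hP, hf]

theorem expFun_smul_pderiv_X_self {i : Fin n} {P : MvPolynomial (Fin n) K}
    (hP : pderiv i P = 0) : expFun (P • pderiv (R := K) i) (X i) = X i + P := by
  rw [expFun_smul_pderiv hP] <;> simp

theorem expFun_smul_pderiv_of_eq_zero {i : Fin n} {P f : MvPolynomial (Fin n) K}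
    (hP : pderiv i P = 0) (hf : pderiv i f = 0) : expFun (P • pderiv (R := K) i) f = f := by
  rw [expFun_smul_pderiv hP] <;> simp [hf]

theorem pderiv_comm (i j : Fin n) (f : MvPolynomial (Fin n) K) :
    pderiv i (pderiv j f) = pderiv j (pderiv i f) := by
  have h : ⁅pderiv (R := K) i, pderiv (R := K) j⁆ = 0 := by
    classical
    apply derivation_ext
    intro k
    rw [Derivation.commutator_apply, pderiv_X, pderiv_X]
    simp only [Pi.single_apply]
    split_ifs <;> simp
  have := DFunLike.congr_fun h f
  rw [Derivation.commutator_apply] at this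
  simpa [sub_eq_zero] using this

theorem mem_expModule_of_affine [CharZero K]
    {H : Subgroup (MvPolynomial (Fin n) K ≃ₐ[K] MvPolynomial (Fin n) K)}
    (hH : ∀ σ, IsAffineEquiv σ → σ ∈ H) {l : Fin n} {g : MvPolynomial (Fin n) K}
    (hg : g ∈ affinePolys n K) (hl : pderiv l g = 0) :
    g ∈ expModule H (isLocallyNilpotent_pderiv l) := by
  refine ⟨hl, fun c => ⟨expAlgEquiv ((c • g) • pderiv l)
    ((isLocallyNilpotent_pderiv l).smul_of_mem_ker (by simp [hl])), hH _ fun i => ?_,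
    fun f => rfl⟩⟩
  change expFun _ (X i) ∈ _
  have hcl : pderiv l (c • g) = 0 := by simp [hl]
  by_cases hi : i = l
  · subst hi
    rw [expFun_smul_pderiv_X_self hcl]
    exact Submodule.add_mem _ (X_mem_affinePolys _) (Submodule.smul_mem _ _ hg)
  · rw [expFun_smul_pderiv_of_eq_zero hcl (pderiv_X_of_ne hi)]
    exact X_mem_affinePolys _

theorem isAffineEquiv_renameEquiv (s : Equiv.Perm (Fin n)) :
    IsAffineEquiv (renameEquiv K s) := fun i => by
  simpa using X_mem_affinePolys _

theorem conjDer_renameEquiv (s : Equiv.Perm (Fin n)) (l : Fin n) :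
    conjDer (renameEquiv K s) (pderiv l) = pderiv (s l) := by
  classical
  apply derivation_ext
  intro k
  rw [conjDer_apply]
  by_cases h : k = s l
  · subst h; simp
  · rw [pderiv_X_of_ne h]
    have : s.symm k ≠ l := by rintro rfl; simp at h
    simp [pderiv_X_of_ne this]

/-- Neither `x_i` nor `x_l` occurs in `P`, so the affine swap of these two variables fixes `P` and
exchanges the derivations. -/
theorem mem_expModule_pderiv_of_pderiv_eq_zero [CharZero K]
    {H : Subgroup (MvPolynomial (Fin n) K ≃ₐ[K] MvPolynomial (Fin n) K)}
    (hH : ∀ σ, IsAffineEquiv σ → σ ∈ H) {i l : Fin n} {P : MvPolynomial (Fin n) K}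
    (hP : P ∈ expModule H (isLocallyNilpotent_pderiv l)) (hi : pderiv i P = 0) :
    P ∈ expModule H (isLocallyNilpotent_pderiv i) := by
  have h1 := conj_mem_expModule (hD' := isLocallyNilpotent_pderiv i) (t := 1)
    (hH _ (isAffineEquiv_renameEquiv (Equiv.swap i l))) one_ne_zero
    (by rw [conjDer_renameEquiv, Equiv.swap_apply_right, one_smul]) hP
  convert h1
  have h2 : P ∈ supported K {j : Fin n | j ≠ i ∧ j ≠ l} := by
    have h3 := mem_supported_of_pderiv_eq_zero hi
    have h4 := mem_supported_of_pderiv_eq_zero hP.1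
    rw [mem_supported] at *
    exact fun j hj => ⟨h3 hj, h4 hj⟩
  have h5 : supported K {j : Fin n | j ≠ i ∧ j ≠ l} ≤
      AlgHom.equalizer (AlgHom.id K (MvPolynomial (Fin n) K)) (rename (Equiv.swap i l)) := by
    refine Algebra.adjoin_le ?_
    rintro _ ⟨j, hj, rfl⟩
    change X j = rename _ (X j)
    rw [rename_X, Equiv.swap_apply_of_ne_of_ne hj.1 hj.2]
  exact h5 h2

/-- `exp(P ∂ᵢ)` with `P` in the module of `∂ₗ` preserves this module. -/
theorem expFun_mem_expModule [CharZero K]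
    {H : Subgroup (MvPolynomial (Fin n) K ≃ₐ[K] MvPolynomial (Fin n) K)}
    (hH : ∀ σ, IsAffineEquiv σ → σ ∈ H) {i l : Fin n} {P g : MvPolynomial (Fin n) K}
    (hP : P ∈ expModule H (isLocallyNilpotent_pderiv l)) (hi : pderiv i P = 0)
    (hg : g ∈ expModule H (isLocallyNilpotent_pderiv l)) :
    expFun (P • pderiv (R := K) i) g ∈ expModule H (isLocallyNilpotent_pderiv l) := by
  have h1 := mem_expModule_pderiv_of_pderiv_eq_zero hH hP hi
  have hLN := (isLocallyNilpotent_pderiv i).smul_of_mem_ker hi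
  refine conj_mem_expModule (expAlgEquiv_mem h1 hLN) one_ne_zero ?_ hg
  rw [one_smul, conjDer_eq_iff]
  intro f
  symm
  refine map_expFun hLN (pderiv (R := K) l).toLinearMap (fun f => ?_) f
  change pderiv l (P • pderiv i f) = P • pderiv i (pderiv l f)
  rw [smul_eq_mul, pderiv_mul, hP.1, zero_mul, zero_add, pderiv_comm, smul_eq_mul]

/-- The diagonal automorphism `x_i ↦ tᵢ x_i`. -/
def diagEquiv (t : Fin n → Kˣ) : MvPolynomial (Fin n) K ≃ₐ[K] MvPolynomial (Fin n) K :=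
  AlgEquiv.ofAlgHom (aeval fun i => C (t i : K) * X i) (aeval fun i => C ((t i)⁻¹ : K) * X i)
    (by
      apply MvPolynomial.algHom_ext
      intro i
      rw [AlgHom.comp_apply, aeval_X, map_mul, aeval_X, algHom_C, algebraMap_eq, ← mul_assoc,
        ← C_mul]
      simp)
    (by
      apply MvPolynomial.algHom_ext
      intro i
      rw [AlgHom.comp_apply, aeval_X, map_mul, aeval_X, algHom_C, algebraMap_eq, ← mul_assoc,
        ← C_mul]
      simp)

theorem diagEquiv_X (t : Fin n → Kˣ) (i : Fin n) : diagEquiv t (X i) = C (t i : K) * X i :=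
  aeval_X _ _

theorem diagEquiv_monomial (t : Fin n → Kˣ) (m : Fin n →₀ ℕ) (c : K) :
    diagEquiv t (monomial m c) = (m.prod fun i k => (t i : K) ^ k) • monomial m c := by
  rw [monomial_eq, map_mul, Finsupp.prod, map_prod, smul_eq_C_mul, Finsupp.prod, map_prod]
  simp only [map_pow, diagEquiv_X, mul_pow, Finset.prod_mul_distrib]
  have : diagEquiv t (C c) = C c := (diagEquiv t).commutes c
  rw [this]
  ring

theorem isAffineEquiv_diagEquiv (t : Fin n → Kˣ) : IsAffineEquiv (diagEquiv t) := fun i => by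
  rw [diagEquiv_X, ← smul_eq_C_mul]
  exact Submodule.smul_mem _ _ (X_mem_affinePolys i)

theorem conjDer_diagEquiv (t : Fin n → Kˣ) (l : Fin n) :
    conjDer (diagEquiv t) (pderiv l) = ((t l)⁻¹ : K) • pderiv l := by
  classical
  have : ∀ k, (diagEquiv t).symm (X k) = C ((t k)⁻¹ : K) * X k := fun k => aeval_X _ _
  apply derivation_ext
  intro k
  rw [conjDer_apply, this, Derivation.smul_apply, ← smul_eq_C_mul, Derivation.map_smul]
  by_cases h : k = l
  · subst h; simp
  · simp [pderiv_X_of_ne h]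

/-- Distinct monomials have distinct torus weights, so a subspace containing the torus orbit of `g`
contains every monomial that occurs in `g`. -/
theorem monomial_mem_of_forall_diagEquiv_mem [Infinite K]
    {W : Submodule K (MvPolynomial (Fin n) K)} {g : MvPolynomial (Fin n) K}
    (hW : ∀ t, diagEquiv t g ∈ W) {m : Fin n →₀ ℕ} (hm : coeff m g ≠ 0) :
    monomial m 1 ∈ W := by
  classical
  by_contra hmW
  obtain ⟨f, hf, hfW⟩ := Submodule.exists_le_ker_of_notMem hmW
  let G : MvPolynomial (Fin n) K := ∑ m ∈ g.support, monomial m (coeff m g * f (monomial m 1))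
  -- At a torus point `t` the value of `G` is `f (diagEquiv t g) = 0`; the product of the variables
  -- handles the points off the torus.
  have hG : G * ∏ i, X i = 0 := by
    apply MvPolynomial.funext
    intro t
    rw [map_mul, map_prod, map_zero]
    by_cases ht : ∀ i, t i ≠ 0
    · have h1 := hfW (hW fun i => Units.mk0 (t i) (ht i))
      rw [LinearMap.mem_ker, as_sum g, map_sum, map_sum] at h1
      have : eval t G = 0 := by
        rw [map_sum, ← h1]
        refine Finset.sum_congr rfl fun a _ => ?_
        rw [diagEquiv_monomial, map_smul, eval_monomial]
        have : monomial a (coeff a g) = coeff a g • monomial a (1 : K) := by simp [smul_monomial]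
        rw [this, map_smul]
        simp only [Units.val_mk0, smul_eq_mul]
        ring
      rw [this, zero_mul]
    · push Not at ht
      obtain ⟨i, hi⟩ := ht
      rw [Finset.prod_eq_zero (Finset.mem_univ i) (by simp [hi]), mul_zero]
  have hG0 : G = 0 := (mul_eq_zero.1 hG).resolve_right
    (Finset.prod_ne_zero_iff.2 fun i _ => X_ne_zero i)
  have hc : coeff m G = coeff m g * f (monomial m 1) := by
    simp only [G, coeff_sum, coeff_monomial]
    rw [Finset.sum_ite_eq' g.support m, if_pos (mem_support_iff.2 hm)]
  rw [hG0, coeff_zero] at hc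
  exact (mul_ne_zero hm hf) hc.symm

/-! ### Monomials in the module of a partial derivative -/

section Monomials

variable [CharZero K] {H : Subgroup (MvPolynomial (Fin n) K ≃ₐ[K] MvPolynomial (Fin n) K)}
  (hH : ∀ σ, IsAffineEquiv σ → σ ∈ H) {l : Fin n}

include hH

theorem monomial_mem_expModule {g : MvPolynomial (Fin n) K}
    (hg : g ∈ expModule H (isLocallyNilpotent_pderiv l)) {m : Fin n →₀ ℕ} (hm : coeff m g ≠ 0) :
    monomial m 1 ∈ expModule H (isLocallyNilpotent_pderiv l) :=
  monomial_mem_of_forall_diagEquiv_mem (fun t => conj_mem_expModule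
    (hH _ (isAffineEquiv_diagEquiv t)) (inv_ne_zero (t l).ne_zero) (conjDer_diagEquiv t l) hg) hm

omit hH in
theorem pderiv_monomial_eq_zero_iff {i : Fin n} {m : Fin n →₀ ℕ} :
    pderiv i (monomial m (1 : K)) = 0 ↔ m i = 0 := by
  rw [pderiv_monomial, monomial_eq_zero]
  simp

/-- Replace `x_i` by `x_i + x^f` in `x^m` and extract a monomial. -/
theorem monomial_substitution_mem {i : Fin n} {m f : Fin n →₀ ℕ} {k : ℕ}
    (hm : monomial m 1 ∈ expModule H (isLocallyNilpotent_pderiv (K := K) l))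
    (hf : monomial f 1 ∈ expModule H (isLocallyNilpotent_pderiv (K := K) l)) (hi : f i = 0)
    (hk : k ≤ m i) :
    monomial (m.erase i + Finsupp.single i k + (m i - k) • f) 1 ∈
      expModule H (isLocallyNilpotent_pderiv (K := K) l) := by
  classical
  have hfi := pderiv_monomial_eq_zero_iff (K := K).2 hi
  have hmem := expFun_mem_expModule hH hf hfi hm
  refine monomial_mem_expModule hH hmem ?_
  have h1 : monomial m (1 : K) = monomial (m.erase i) 1 * X i ^ m i := by
    rw [X_pow_eq_monomial, monomial_mul, mul_one, Finsupp.erase_add_single]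
  let σ := expAlgEquiv (monomial f (1 : K) • pderiv (R := K) i)
    ((isLocallyNilpotent_pderiv i).smul_of_mem_ker hfi)
  have h2 : expFun (monomial f (1 : K) • pderiv (R := K) i) (monomial m 1) =
      ∑ k ∈ Finset.range (m i + 1),
        monomial (m.erase i + Finsupp.single i k + (m i - k) • f) ((m i).choose k : K) := by
    change σ _ = _
    rw [h1, map_mul, map_pow]
    change expFun _ _ * (expFun _ _) ^ _ = _
    rw [expFun_smul_pderiv_X_self hfi, expFun_smul_pderiv_of_eq_zero hfi
      (pderiv_monomial_eq_zero_iff.2 (by simp)), add_pow, Finset.mul_sum]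
    refine Finset.sum_congr rfl fun k _ => ?_
    rw [X_pow_eq_monomial, monomial_pow, one_pow, ← C_eq_coe_nat, C_apply]
    simp only [monomial_mul, one_mul, add_zero, add_assoc]
  rw [h2, coeff_sum, Finset.sum_eq_single k]
  · rw [coeff_monomial, if_pos rfl]
    exact_mod_cast (Nat.choose_pos hk).ne'
  · intro j _ hj
    rw [coeff_monomial, if_neg]
    intro h
    have := DFunLike.congr_fun h i
    simp [hi] at this
    exact hj this
  · intro h
    simp at h
    omega

/-- Substituting `x_i + 1` for `x_i` and extracting a monomial lowers one exponent at will; this is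
done variable by variable. -/
theorem monomial_mem_of_le {m m' : Fin n →₀ ℕ} (hle : m' ≤ m)
    (hm : monomial m 1 ∈ expModule H (isLocallyNilpotent_pderiv (K := K) l)) :
    monomial m' 1 ∈ expModule H (isLocallyNilpotent_pderiv (K := K) l) := by
  classical
  have h0 : monomial 0 1 ∈ expModule H (isLocallyNilpotent_pderiv (K := K) l) :=
    mem_expModule_of_affine hH one_mem_affinePolys (by simp)
  have key : ∀ s : Finset (Fin n), ∃ q : Fin n →₀ ℕ,
      monomial q 1 ∈ expModule H (isLocallyNilpotent_pderiv (K := K) l) ∧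
      ∀ k, q k = if k ∈ s then m' k else m k := by
    intro s
    induction s using Finset.induction_on with
    | empty => exact ⟨m, hm, by simp⟩
    | insert i s his ih =>
      obtain ⟨q, hq, hqk⟩ := ih
      refine ⟨q.erase i + Finsupp.single i (m' i) + (q i - m' i) • 0,
        monomial_substitution_mem hH hq h0 rfl ?_, fun k => ?_⟩
      · rw [hqk, if_neg his]
        exact hle i
      · by_cases hk : k = i
        · subst hk; simp
        · simp [hk, hqk]
  obtain ⟨q, hq, hqk⟩ := key Finset.univ
  convert hq
  ext k
  simp [hqk]

/-- If no exponent reaches two, some `x_i x_j` with `i ≠ j` divides the monomial, and replacing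
`x_j` by `x_j + x_i` produces `x_i²`. -/
theorem monomial_single_two_mem {m : Fin n →₀ ℕ} (hdeg : 2 ≤ m.degree)
    (hm : monomial m 1 ∈ expModule H (isLocallyNilpotent_pderiv (K := K) l)) :
    ∃ i, monomial (Finsupp.single i 2) 1 ∈ expModule H (isLocallyNilpotent_pderiv (K := K) l) := by
  classical
  by_cases h : ∃ i, 2 ≤ m i
  · obtain ⟨i, hi⟩ := h
    exact ⟨i, monomial_mem_of_le hH (by simpa using hi) hm⟩
  · push Not at h
    have hcard : 1 < m.support.card := by
      have h1 : m.degree ≤ ∑ i ∈ m.support, 1 :=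
        Finset.sum_le_sum fun i _ => by have := h i; omega
      simp at h1
      omega
    obtain ⟨i, hi, j, hj, hij⟩ := Finset.one_lt_card.1 hcard
    rw [Finsupp.mem_support_iff] at hi hj
    have h1 : monomial (Finsupp.single i 1) 1 ∈
        expModule H (isLocallyNilpotent_pderiv (K := K) l) :=
      monomial_mem_of_le hH (by simpa using Nat.one_le_iff_ne_zero.2 hi) hm
    have h2 : monomial (Finsupp.single i 1 + Finsupp.single j 1) 1 ∈
        expModule H (isLocallyNilpotent_pderiv (K := K) l) := by
      refine monomial_mem_of_le hH (fun k => ?_) hm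
      by_cases hki : k = i
      · subst hki; simp [hij.symm]; omega
      · by_cases hkj : k = j
        · subst hkj; simp [hij]; omega
        · simp [Ne.symm hki, Ne.symm hkj]
    have h3 := monomial_substitution_mem hH (i := j) (k := 0) h2 h1 (by simp [hij]) (by simp)
    refine ⟨i, ?_⟩
    convert h3
    ext k
    by_cases hkj : k = j
    · subst hkj; simp [hij]
    · by_cases hki : k = i
      · subst hki; simp [hij.symm]
      · simp [Finsupp.single_apply, Ne.symm hki, hkj]

/-- Torus weights give a monomial of degree at least two, hence one square, hence all squares of
variables other than `x_l`. These raise exponents through a third variable, and arbitrary monomials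
are then assembled one variable at a time. -/
theorem mem_expModule_of_nonaffine (hn : 3 ≤ n) {g : MvPolynomial (Fin n) K}
    (hg : g ∈ expModule H (isLocallyNilpotent_pderiv l)) (hg' : g ∉ affinePolys n K)
    {P : MvPolynomial (Fin n) K} (hP : pderiv l P = 0) :
    P ∈ expModule H (isLocallyNilpotent_pderiv l) := by
  classical
  set W := expModule H (isLocallyNilpotent_pderiv (K := K) l) with hW
  have hl : ∀ {m}, monomial m 1 ∈ W → m l = 0 := fun h => pderiv_monomial_eq_zero_iff.1 h.1
  have h0 : monomial 0 1 ∈ W := mem_expModule_of_affine hH one_mem_affinePolys (by simp)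
  have h1 : ∀ i, i ≠ l → monomial (Finsupp.single i 1) 1 ∈ W := fun i hi =>
    mem_expModule_of_affine hH (X_mem_affinePolys i) (pderiv_X_of_ne hi)
  obtain ⟨m, hm, hdeg⟩ : ∃ m ∈ g.support, 2 ≤ m.degree := by
    by_contra hcon
    push Not at hcon
    refine hg' (mem_affinePolys.2 (Finset.sup_le fun m hm => ?_))
    exact Nat.le_of_lt_succ (hcon m hm)
  obtain ⟨i, hi⟩ := monomial_single_two_mem hH hdeg
    (monomial_mem_expModule hH hg (mem_support_iff.1 hm))
  have hil : i ≠ l := by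
    rintro rfl
    simpa using hl hi
  have h2 : ∀ j, j ≠ l → monomial (Finsupp.single j 2) 1 ∈ W := by
    intro j hj
    by_cases hij : j = i
    · rwa [hij]
    · have := monomial_substitution_mem hH (i := i) (k := 0) hi (h1 j hj) (by simp [hij])
        (by simp)
      simpa using this
  have h3 : ∀ i, i ≠ l → ∀ d, monomial (Finsupp.single i d) 1 ∈ W := by
    intro i hi d
    induction d with
    | zero => simpa using h0
    | succ d ih =>
      rcases Nat.eq_zero_or_pos d with rfl | hd
      · exact h1 i hi
      -- This is where `n ≥ 3` enters: `x_j + x_i ^ d` put into `x_j²` yields `x_i ^ (2 * d)`, and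
      -- `2 * d ≥ d + 1`.
      · obtain ⟨j, hj⟩ : ∃ j : Fin n, j ∉ ({i, l} : Finset (Fin n)) := by
          by_contra hcon
          push Not at hcon
          have := Finset.card_le_card (fun x _ => hcon x : (Finset.univ : Finset (Fin n)) ⊆ _)
          have h' := Finset.card_le_two (a := i) (b := l)
          rw [Finset.card_univ, Fintype.card_fin] at this
          omega
        simp only [Finset.mem_insert, Finset.mem_singleton, not_or] at hj
        have := monomial_substitution_mem hH (i := j) (k := 0) (h2 j hj.2) ih
          (by simp [Ne.symm hj.1]) (by simp)
        refine monomial_mem_of_le hH (m := Finsupp.single i (2 * d)) ?_ (by simpa using this)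
        simp only [Finsupp.single_le_single]
        omega
  have h4 : ∀ m : Fin n →₀ ℕ, m l = 0 → monomial m 1 ∈ W := by
    intro m
    induction m using Finsupp.induction with
    | zero => exact fun _ => h0
    | single_add i b f hif hb ih =>
      intro hml
      have hi : i ≠ l := by
        rintro rfl
        simp [hb] at hml
      have hfl : f l = 0 := by simpa [hi] using hml
      -- The term of `(x_i + x^f) ^ (b + 1)` linear in `x^f` is a multiple of `x_i ^ b x^f`.
      have := monomial_substitution_mem hH (i := i) (k := b) (h3 i hi (b + 1)) (ih hfl)
        (by simpa using hif) (by simp)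
      simpa using this
  rw [as_sum P]
  refine Submodule.sum_mem _ fun m hm => ?_
  have : monomial m (coeff m P) = coeff m P • monomial m (1 : K) := by simp [smul_monomial]
  rw [this]
  refine Submodule.smul_mem _ _ (h4 m ?_)
  by_contra hml
  have hs := mem_supported_of_pderiv_eq_zero hP
  rw [mem_supported] at hs
  exact hs (mem_vars_iff_mem_support _ |>.2 ⟨m, hm, Finsupp.mem_support_iff.2 hml⟩) rfl

end Monomials

/-! ### Triangular automorphisms as products of elementary ones -/

theorem pderiv_eq_zero_of_mem_lowerPolys {i j : Fin n} (hij : i ≤ j) {P : MvPolynomial (Fin n) K}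
    (hP : P ∈ lowerPolys K i) : pderiv j P = 0 := by
  refine pderiv_eq_zero_of_notMem_vars fun hj => ?_
  have : j < i := mem_supported.1 hP hj
  exact absurd this (not_lt.2 hij)

/-- Elementary factors clear the lower-variable parts `P`, starting from the first coordinate, until
a diagonal automorphism remains. The induction is on the number `d` of coordinates not yet known to
be diagonal. -/
theorem mem_of_triangular [CharZero K]
    {H : Subgroup (MvPolynomial (Fin n) K ≃ₐ[K] MvPolynomial (Fin n) K)}
    (hH : ∀ σ, IsAffineEquiv σ → σ ∈ H)
    (helem : ∀ (i : Fin n) (P : MvPolynomial (Fin n) K), pderiv i P = 0 →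
      P ∈ expModule H (isLocallyNilpotent_pderiv i))
    {σ : MvPolynomial (Fin n) K ≃ₐ[K] MvPolynomial (Fin n) K}
    (hσ : ∀ i, ∃ u : Kˣ, ∃ P ∈ lowerPolys K i, σ (X i) = C (u : K) * X i + P) : σ ∈ H := by
  have key : ∀ d : ℕ, ∀ σ : MvPolynomial (Fin n) K ≃ₐ[K] MvPolynomial (Fin n) K,
      (∀ i, ∃ u : Kˣ, ∃ P ∈ lowerPolys K i, σ (X i) = C (u : K) * X i + P) →
      (∀ i : Fin n, i.val + d < n → ∃ u : Kˣ, σ (X i) = C (u : K) * X i) → σ ∈ H := by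
    intro d
    induction d with
    | zero =>
      intro σ _ hσ
      refine hH _ fun i => ?_
      obtain ⟨u, hu⟩ := hσ i i.2
      rw [hu, ← smul_eq_C_mul]
      exact Submodule.smul_mem _ _ (X_mem_affinePolys i)
    | succ d ih =>
      intro σ h1 h2
      by_cases hd : d + 1 ≤ n
      swap
      · refine ih σ h1 fun i hi => ?_
        omega
      let m : Fin n := ⟨n - (d + 1), by omega⟩
      obtain ⟨u, P, hP, hu⟩ := h1 m
      -- Chosen so that `u (X m + Q) + P = u X m`.
      set Q : MvPolynomial (Fin n) K := -((u⁻¹ : Kˣ) : K) • P with hQ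
      have hPm := pderiv_eq_zero_of_mem_lowerPolys le_rfl hP
      have hQm : pderiv m Q = 0 := by rw [hQ, Derivation.map_smul, hPm, smul_zero]
      have hQl : Q ∈ lowerPolys K m := Subalgebra.smul_mem _ hP _
      let ψ := expAlgEquiv (Q • pderiv (R := K) m)
        ((isLocallyNilpotent_pderiv m).smul_of_mem_ker hQm)
      have hψH : ψ ∈ H := expAlgEquiv_mem (helem m Q hQm) _
      have hψm : ψ (X m) = X m + Q := expFun_smul_pderiv_X_self hQm
      have hψ : ∀ f, pderiv m f = 0 → ψ f = f := fun f hf =>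
        expFun_smul_pderiv_of_eq_zero hQm hf
      have hψC : ∀ c : K, ψ (C c) = C c := fun c => ψ.commutes c
      have hψl : ∀ j, m < j → ∀ f ∈ lowerPolys K j, ψ f ∈ lowerPolys K j := by
        intro j hj
        change lowerPolys K j ≤ (lowerPolys K j).comap (ψ : MvPolynomial (Fin n) K →ₐ[K] _)
        refine Algebra.adjoin_le ?_
        rintro _ ⟨k, hk, rfl⟩
        change ψ (X k) ∈ lowerPolys K j
        have hk' : X k ∈ lowerPolys K j := X_mem_supported.2 hk
        by_cases hkm : k = m
        · rw [hkm] at hk' ⊢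
          rw [hψm]
          exact Subalgebra.add_mem _ hk' (supported_mono (fun x hx => lt_trans hx hj) hQl)
        · rwa [hψ _ (pderiv_X_of_ne hkm)]
      have hlt : ∀ i, i < m → ∃ v : Kˣ, (ψ * σ) (X i) = C (v : K) * X i := by
        intro i hi
        obtain ⟨v, hv⟩ := h2 i (by have : i.val < n - (d + 1) := hi; omega)
        refine ⟨v, ?_⟩
        rw [AlgEquiv.mul_apply, hv, map_mul, hψC, hψ _ (pderiv_X_of_ne hi.ne)]
      have hm : (ψ * σ) (X m) = C (u : K) * X m := by
        rw [AlgEquiv.mul_apply, hu, map_add, map_mul, hψC, hψm, hψ P hPm, hQ, smul_eq_C_mul,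
          mul_add, ← mul_assoc, ← C_mul]
        simp
      have hmem : ψ * σ ∈ H := by
        refine ih _ (fun i => ?_) fun i hi => ?_
        · rcases lt_trichotomy i m with hi | rfl | hi
          · obtain ⟨v, hv⟩ := hlt i hi
            exact ⟨v, 0, Subalgebra.zero_mem _, by rw [hv, add_zero]⟩
          · exact ⟨u, 0, Subalgebra.zero_mem _, by rw [hm, add_zero]⟩
          · obtain ⟨v, R, hR, hv⟩ := h1 i
            refine ⟨v, ψ R, hψl i hi R hR, ?_⟩
            rw [AlgEquiv.mul_apply, hv, map_add, map_mul, hψC, hψ _ (pderiv_X_of_ne hi.ne')]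
        · rcases lt_or_eq_of_le (show i ≤ m by
            change i.val ≤ n - (d + 1)
            omega) with hi | rfl
          · exact hlt i hi
          · exact ⟨u, hm⟩
      exact (H.mul_mem_cancel_left hψH).1 hmem
  exact key n σ hσ fun i hi => by omega

/-- A group of automorphisms that contains the affine ones, and a non-affine elementary one with
all its scalar multiples, contains the triangular automorphisms. -/
theorem triangular_mem_of_nonaffine [CharZero K] (hn : 3 ≤ n)
    {H : Subgroup (MvPolynomial (Fin n) K ≃ₐ[K] MvPolynomial (Fin n) K)}
    (hH : ∀ σ, IsAffineEquiv σ → σ ∈ H) {l : Fin n} {g : MvPolynomial (Fin n) K}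
    (hg : g ∈ expModule H (isLocallyNilpotent_pderiv l)) (hg' : g ∉ affinePolys n K)
    {σ : MvPolynomial (Fin n) K ≃ₐ[K] MvPolynomial (Fin n) K}
    (hσ : ∀ i, ∃ u : Kˣ, ∃ P ∈ lowerPolys K i, σ (X i) = C (u : K) * X i + P) : σ ∈ H := by
  refine mem_of_triangular hH (fun i P hP => ?_) hσ
  let ρ := renameEquiv K (Equiv.swap l i)
  have h1 : conjDer ρ (pderiv l) = (1 : K) • pderiv i := by
    rw [conjDer_renameEquiv, Equiv.swap_apply_left, one_smul]
  have h2 : pderiv l (ρ.symm P) = 0 := by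
    have h3 := conjDer_map ρ (pderiv l) (ρ.symm P)
    rw [h1, one_smul, ρ.apply_symm_apply, hP] at h3
    exact (map_eq_zero_iff ρ ρ.injective).1 h3.symm
  have h4 := conj_mem_expModule (hD' := isLocallyNilpotent_pderiv i)
    (hH _ (isAffineEquiv_renameEquiv _)) one_ne_zero h1
    (mem_expModule_of_nonaffine hH hn hg hg' h2)
  rwa [ρ.apply_symm_apply] at h4

/-! ### Automorphisms that conjugate translations to translations -/

/-- The elementary shears in the direction `x_l` by polynomials of degree one are conjugated by
`φ ∈ H` to exponentials of multiples of the conjugate derivation. -/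
theorem map_mem_expModule_conjDer [CharZero K]
    {H : Subgroup (MvPolynomial (Fin n) K ≃ₐ[K] MvPolynomial (Fin n) K)}
    (hH : ∀ σ, IsAffineEquiv σ → σ ∈ H) {φ : MvPolynomial (Fin n) K ≃ₐ[K] MvPolynomial (Fin n) K}
    (hφ : φ ∈ H) {l : Fin n} {E : Derivation K (MvPolynomial (Fin n) K) (MvPolynomial (Fin n) K)}
    (hE : IsLocallyNilpotent E) (h : conjDer φ (pderiv l) = E) {p : MvPolynomial (Fin n) K}
    (hp : p ∈ affinePolys n K) (hl : pderiv l p = 0) : φ p ∈ expModule H hE :=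
  conj_mem_expModule hφ one_ne_zero (by rw [h, one_smul]) (mem_expModule_of_affine hH hp hl)

/-- If some `φ (X j)` with `j ≠ l` is non-affine, it is already a non-affine element of the module
of `∂_l`. Otherwise `φ` is an affine `α` times `exp(q ∂_l)`, and conjugation by scalings of `x_l`
gives `exp(c q ∂_l)` for all nonzero `c`, so `q` serves instead. -/
theorem triangular_mem_of_conj_pderiv_eq_pderiv [CharZero K] (hn : 3 ≤ n)
    {H : Subgroup (MvPolynomial (Fin n) K ≃ₐ[K] MvPolynomial (Fin n) K)}
    (hH : ∀ σ, IsAffineEquiv σ → σ ∈ H) {φ : MvPolynomial (Fin n) K ≃ₐ[K] MvPolynomial (Fin n) K}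
    (hφ : φ ∈ H) (hna : ¬ IsAffineEquiv φ) {l : Fin n}
    (h : conjDer φ (pderiv l) = pderiv l)
    {σ : MvPolynomial (Fin n) K ≃ₐ[K] MvPolynomial (Fin n) K}
    (hσ : ∀ i, ∃ u : Kˣ, ∃ P ∈ lowerPolys K i, σ (X i) = C (u : K) * X i + P) : σ ∈ H := by
  have hcomm : ∀ f, pderiv l (φ f) = φ (pderiv l f) := fun f => (conjDer_eq_iff.1 h f).symm
  by_cases hX : ∀ j, j ≠ l → φ (X j) ∈ affinePolys n K
  swap
  · push Not at hX
    obtain ⟨j, hj, hj'⟩ := hX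
    exact triangular_mem_of_nonaffine hn hH (map_mem_expModule_conjDer hH hφ _ h
      (X_mem_affinePolys j) (pderiv_X_of_ne hj)) hj' hσ
  -- The affine part of `φ`: it agrees with `φ` on polynomials free of `x_l`, and fixes `x_l`.
  let f : MvPolynomial (Fin n) K →ₐ[K] MvPolynomial (Fin n) K :=
    aeval fun i => if i = l then X l else φ (X i)
  have hfl : f (X l) = X l := by simp [f]
  have hfX : ∀ i, i ≠ l → f (X i) = φ (X i) := fun i hi => by simp [f, hi]
  have hfφ : ∀ p, pderiv l p = 0 → f p = φ p := by
    intro p hp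
    have h1 := mem_supported_of_pderiv_eq_zero hp
    have h2 : supported K {j : Fin n | j ≠ l} ≤
        AlgHom.equalizer f (φ : MvPolynomial (Fin n) K →ₐ[K] _) := by
      refine Algebra.adjoin_le ?_
      rintro _ ⟨j, hj, rfl⟩
      exact hfX j hj
    exact h2 h1
  have hfcomm : ∀ p ∈ affinePolys n K, pderiv l (f p) = f (pderiv l p) := by
    intro p hp
    refine eqOn_affinePolys (f := (pderiv l).toLinearMap ∘ₗ f.toLinearMap)
      (g := f.toLinearMap ∘ₗ (pderiv l).toLinearMap) (by simp) (fun i => ?_) hp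
    change pderiv l (f (X i)) = f (pderiv l (X i))
    by_cases hi : i = l
    · subst hi
      rw [hfl, pderiv_X_self, map_one]
    · rw [hfX i hi, hcomm, pderiv_X_of_ne hi, map_zero, map_zero]
  obtain ⟨α, hα, hαf⟩ := exists_affineEquiv_of_injOn f (fun i => by
    by_cases hi : i = l
    · rw [hi, hfl]
      exact X_mem_affinePolys l
    · rw [hfX i hi]
      exact hX i hi) (fun p hp hfp => by
    have h1 : pderiv l (pderiv l p) = 0 := by
      refine eqOn_affinePolys (f := (pderiv l).toLinearMap ∘ₗ (pderiv l).toLinearMap) (g := 0)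
        (by simp) (fun i => ?_) hp
      change pderiv l (pderiv l (X i)) = 0
      by_cases hi : i = l
      · rw [hi, pderiv_X_self, pderiv_one]
      · rw [pderiv_X_of_ne hi, map_zero]
    have h2 : pderiv l p = 0 := by
      have := hfcomm p hp
      rw [hfp, map_zero, hfφ _ h1] at this
      exact (map_eq_zero_iff φ φ.injective).1 this.symm
    rw [hfφ p h2] at hfp
    exact (map_eq_zero_iff φ φ.injective).1 hfp)
  have hq0 : pderiv l (φ.symm (φ (X l) - X l)) = 0 := by
    apply φ.injective
    rw [← hcomm, φ.apply_symm_apply, map_sub, hcomm, pderiv_X_self, map_one, sub_self, map_zero]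
  -- As `α` and `φ` agree on `q`, this gives `φ (X l) = α (X l + q)`, so `φ = α exp(q ∂_l)`.
  set q := φ.symm (φ (X l) - X l) with hq
  have hφq : φ q = φ (X l) - X l := φ.apply_symm_apply _
  have hmem : q ∈ expModule H (isLocallyNilpotent_pderiv l) := by
    have hψ : ∀ c : Kˣ, ∃ τ ∈ H, ∀ f, τ f = expFun (((c : K) • q) • pderiv l) f := by
      intro c
      classical
      let t : Fin n → Kˣ := fun i => if i = l then c else 1
      have hσt : (diagEquiv t)⁻¹ * (α⁻¹ * φ) * diagEquiv t ∈ H :=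
        H.mul_mem (H.mul_mem (H.inv_mem (hH _ (isAffineEquiv_diagEquiv t)))
          (H.mul_mem (H.inv_mem (hH _ hα)) hφ)) (hH _ (isAffineEquiv_diagEquiv t))
      refine ⟨_, hσt, fun f => ?_⟩
      have hcq : pderiv l ((c : K) • q) = 0 := by rw [Derivation.map_smul, hq0, smul_zero]
      let ρ := expAlgEquiv (((c : K) • q) • pderiv (R := K) l)
        ((isLocallyNilpotent_pderiv l).smul_of_mem_ker hcq)
      have hdfix : ∀ p, pderiv l p = 0 → diagEquiv t p = p := by
        intro p hp
        have h2 : supported K {j : Fin n | j ≠ l} ≤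
            AlgHom.equalizer (diagEquiv t : MvPolynomial (Fin n) K →ₐ[K] _) (AlgHom.id K _) := by
          refine Algebra.adjoin_le ?_
          rintro _ ⟨j, hj, rfl⟩
          have : t j = 1 := if_neg hj
          change diagEquiv t (X j) = X j
          rw [diagEquiv_X, this]
          simp
        exact h2 (mem_supported_of_pderiv_eq_zero hp)
      have hEq : φ * diagEquiv t = α * diagEquiv t * ρ := by
        apply AlgEquiv.coe_toAlgHom_injective
        apply MvPolynomial.algHom_ext
        intro i
        change φ (diagEquiv t (X i)) = α (diagEquiv t (expFun _ (X i)))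
        by_cases hi : i = l
        · subst hi
          have htc : t i = c := if_pos rfl
          rw [expFun_smul_pderiv_X_self hcq, map_add, map_add, diagEquiv_X, htc, map_smul,
            hdfix q hq0, ← smul_eq_C_mul, map_smul, map_smul, map_smul, hαf, hαf, hfl,
            hfφ q hq0, hφq, ← smul_add]
          congr 1
          ring
        · rw [expFun_smul_pderiv_of_eq_zero hcq (pderiv_X_of_ne hi),
            hdfix _ (pderiv_X_of_ne hi), hαf, hfX i hi]
      have : (diagEquiv t)⁻¹ * (α⁻¹ * φ) * diagEquiv t = ρ := by
        rw [mul_assoc, mul_assoc, hEq]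
        group
      rw [this]
      rfl
    refine ⟨hq0, fun c => ?_⟩
    by_cases hc : c = 0
    · exact ⟨1, H.one_mem, fun f => by simp [hc, expFun_zero]⟩
    · exact hψ (Units.mk0 c hc)
  refine triangular_mem_of_nonaffine hn hH hmem (fun hqa => hna fun i => ?_) hσ
  by_cases hi : i = l
  · have h1 : φ (X l) = α q + X l := by
      rw [hαf, hfφ q hq0, hφq]
      ring
    rw [hi, h1]
    exact Submodule.add_mem _ (hα.map_mem hqa) (X_mem_affinePolys l)
  · exact hX i hi

theorem ne_zero_of_conj_pderiv_eq_constDer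
    {φ : MvPolynomial (Fin n) K ≃ₐ[K] MvPolynomial (Fin n) K} {l : Fin n} {u : Fin n → K}
    (h : conjDer φ (pderiv l) = constDer u) : u ≠ 0 := by
  rintro rfl
  have h1 : constDer (0 : Fin n → K) = 0 := by
    apply derivation_ext
    intro i
    simp [constDer_X]
  have h2 := conjDer_map φ (pderiv l) (X l)
  rw [h, h1, pderiv_X_self, map_one] at h2
  exact zero_ne_one h2

theorem triangular_mem_of_conj_pderiv_eq_constDer [CharZero K] (hn : 3 ≤ n)
    {H : Subgroup (MvPolynomial (Fin n) K ≃ₐ[K] MvPolynomial (Fin n) K)}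
    (hH : ∀ σ, IsAffineEquiv σ → σ ∈ H) {φ : MvPolynomial (Fin n) K ≃ₐ[K] MvPolynomial (Fin n) K}
    (hφ : φ ∈ H) (hna : ¬ IsAffineEquiv φ) {l : Fin n} {u : Fin n → K}
    (h : conjDer φ (pderiv l) = constDer u)
    {σ : MvPolynomial (Fin n) K ≃ₐ[K] MvPolynomial (Fin n) K}
    (hσ : ∀ i, ∃ u : Kˣ, ∃ P ∈ lowerPolys K i, σ (X i) = C (u : K) * X i + P) : σ ∈ H := by
  obtain ⟨β, hβ, hβc⟩ := exists_affineEquiv_conj_pderiv l (ne_zero_of_conj_pderiv_eq_constDer h)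
  refine triangular_mem_of_conj_pderiv_eq_pderiv hn hH (φ := β⁻¹ * φ) (l := l)
    (H.mul_mem (H.inv_mem (hH _ hβ)) hφ) (fun hcon => hna ?_) ?_ hσ
  · have := hβ.mul hcon
    rwa [mul_inv_cancel_left] at this
  · rw [conjDer_mul, h, ← hβc, ← conjDer_mul, inv_mul_cancel]
    ext f
    rfl

/-! ### Gradings of the polynomial ring defined on polynomials of degree at most one -/

/-- The algebra homomorphism `A → A[T]` that sends `p` of degree at most one to
`∑_{j < s} p_j Tʲ`, where `p_j` is the `j`-th component of `p`. -/
def gradingHom (s : ℕ) (π : ℕ → affinePolys n K →ₗ[K] affinePolys n K) :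
    MvPolynomial (Fin n) K →ₐ[K] Polynomial (MvPolynomial (Fin n) K) :=
  aeval fun i => ∑ j ∈ Finset.range s,
    Polynomial.C (π j ⟨X i, X_mem_affinePolys i⟩ : MvPolynomial (Fin n) K) * Polynomial.X ^ j

/-- A complete family of orthogonal projections of the space of polynomials of degree at most one,
with `1` of degree zero. -/
structure IsGrading (s : ℕ) (π : ℕ → affinePolys n K →ₗ[K] affinePolys n K) : Prop where
  sum_apply : ∀ x, ∑ j ∈ Finset.range s, π j x = x
  apply_apply : ∀ i j, i < s → j < s → ∀ x, π i (π j x) = if i = j then π j x else 0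
  apply_one : ∀ j, j < s →
    π j ⟨1, one_mem_affinePolys⟩ = if j = 0 then ⟨1, one_mem_affinePolys⟩ else 0
  pos : 0 < s

namespace IsGrading

variable {s : ℕ} {π : ℕ → affinePolys n K →ₗ[K] affinePolys n K} (hπ : IsGrading s π)

include hπ

theorem gradingHom_apply (p : affinePolys n K) :
    gradingHom s π p = ∑ j ∈ Finset.range s,
      Polynomial.C (π j p : MvPolynomial (Fin n) K) * Polynomial.X ^ j := by
  let L : affinePolys n K →ₗ[K] Polynomial (MvPolynomial (Fin n) K) :=
    ∑ j ∈ Finset.range s, (LinearMap.mulRight K (Polynomial.X ^ j)) ∘ₗ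
      (Polynomial.CAlgHom (R := K) (A := MvPolynomial (Fin n) K)).toLinearMap ∘ₗ
      (affinePolys n K).subtype ∘ₗ π j
  have hL : ∀ p, L p = ∑ j ∈ Finset.range s,
      Polynomial.C (π j p : MvPolynomial (Fin n) K) * Polynomial.X ^ j := fun p => by
    simp [L, LinearMap.sum_apply]
  rw [← hL]
  have h1 : L ⟨1, one_mem_affinePolys⟩ = 1 := by
    rw [hL, Finset.sum_eq_single 0]
    · rw [hπ.apply_one 0 hπ.pos, if_pos rfl]
      simp
    · intro j hj hj0
      rw [hπ.apply_one j (Finset.mem_range.1 hj), if_neg hj0]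
      simp
    · intro h
      exact absurd (Finset.mem_range.2 hπ.pos) h
  have hX : ∀ i, L ⟨X i, X_mem_affinePolys i⟩ = gradingHom s π (X i) := fun i => by
    rw [hL, gradingHom, aeval_X]
  conv_rhs => rw [affinePolys_decomposition p]
  conv_lhs => rw [eq_of_mem_affinePolys p.2]
  rw [map_add L, map_sum L, map_smul L, h1]
  simp only [map_smul L, hX, C_eq_smul_one, map_add, map_sum, map_smul, map_one]

theorem gradingHom_eq_of_proj_eq {p : affinePolys n K} {d : ℕ} (hd : d < s) (hp : π d p = p) :
    gradingHom s π p = Polynomial.C (p : MvPolynomial (Fin n) K) * Polynomial.X ^ d := by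
  rw [hπ.gradingHom_apply, Finset.sum_eq_single d, hp]
  · intro j hj hjd
    rw [← hp, hπ.apply_apply j d (Finset.mem_range.1 hj) hd, if_neg hjd]
    simp
  · intro h
    exact absurd (Finset.mem_range.2 hd) h

theorem eval_gradingHom (c : K) (p : affinePolys n K) :
    (gradingHom s π p).eval (C c) =
      ((∑ j ∈ Finset.range s, c ^ j • π j p : affinePolys n K) : MvPolynomial (Fin n) K) := by
  rw [hπ.gradingHom_apply, Polynomial.eval_finsetSum, Submodule.coe_sum]
  refine Finset.sum_congr rfl fun j _ => ?_
  rw [Polynomial.eval_mul, Polynomial.eval_C, Polynomial.eval_pow, Polynomial.eval_X,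
    Submodule.coe_smul, smul_eq_C_mul, C_pow, mul_comm]

/-- The automorphism that multiplies the component of degree `j` by `cʲ`. -/
theorem exists_affineEquiv_eval {c : K} (hc : c ≠ 0) :
    ∃ σ : MvPolynomial (Fin n) K ≃ₐ[K] MvPolynomial (Fin n) K, IsAffineEquiv σ ∧
      ∀ f, σ f = (gradingHom s π f).eval (C c) := by
  let f : MvPolynomial (Fin n) K →ₐ[K] MvPolynomial (Fin n) K :=
    ((Polynomial.aeval (R := MvPolynomial (Fin n) K) (C c)).restrictScalars K).comp
      (gradingHom s π)
  have hf : ∀ p, f p = (gradingHom s π p).eval (C c) := fun p => by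
    change Polynomial.aeval _ _ = _
    rw [Polynomial.coe_aeval_eq_eval]
    rfl
  simp only [← hf]
  refine exists_affineEquiv_of_injOn f (fun i => ?_) fun p hp h => ?_
  · rw [hf]
    rw [hπ.eval_gradingHom c ⟨X i, X_mem_affinePolys i⟩]
    exact SetLike.coe_mem _
  · rw [hf, hπ.eval_gradingHom c ⟨p, hp⟩] at h
    have h1 : (∑ j ∈ Finset.range s, c ^ j • π j ⟨p, hp⟩ : affinePolys n K) = 0 := Subtype.ext h
    have h2 : ∀ i ∈ Finset.range s, π i ⟨p, hp⟩ = 0 := by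
      intro i hi
      have h3 := congrArg (π i) h1
      rw [map_sum, map_zero, Finset.sum_eq_single i] at h3
      · rw [map_smul, hπ.apply_apply i i (Finset.mem_range.1 hi) (Finset.mem_range.1 hi),
          if_pos rfl] at h3
        exact (smul_eq_zero.1 h3).resolve_left (pow_ne_zero i hc)
      · intro j hj hji
        rw [map_smul, hπ.apply_apply i j (Finset.mem_range.1 hi) (Finset.mem_range.1 hj),
          if_neg (Ne.symm hji), smul_zero]
      · exact fun h => absurd hi h
    have h4 := hπ.sum_apply ⟨p, hp⟩
    rw [Finset.sum_eq_zero h2] at h4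
    exact (congrArg Subtype.val h4).symm

/-- If the grading rescales `E`, the module of `E` is graded. -/
theorem coeff_gradingHom_mem [CharZero K]
    {H : Subgroup (MvPolynomial (Fin n) K ≃ₐ[K] MvPolynomial (Fin n) K)}
    (hH : ∀ σ, IsAffineEquiv σ → σ ∈ H)
    {E : Derivation K (MvPolynomial (Fin n) K) (MvPolynomial (Fin n) K)}
    (hE : IsLocallyNilpotent E) (N : affinePolys n K →ₗ[K] affinePolys n K)
    (hN : ∀ p : affinePolys n K, E p = N p)
    (hs : ∀ c : K, c ≠ 0 → ∃ a : K, a ≠ 0 ∧ ∀ x, N (∑ j ∈ Finset.range s, c ^ j • π j x) =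
      a • ∑ j ∈ Finset.range s, c ^ j • π j (N x))
    {g : MvPolynomial (Fin n) K} (hg : g ∈ expModule H hE) (d : ℕ) :
    (gradingHom s π g).coeff d ∈ expModule H hE := by
  by_cases hd : d < (gradingHom s π g).natDegree + 1
  swap
  · rw [Polynomial.coeff_eq_zero_of_natDegree_lt (by omega)]
    exact Submodule.zero_mem _
  refine mem_of_forall_sum_pow_smul_mem (expModule H hE) (fun c hc => ?_) hd
  obtain ⟨σ, hσ, hσe⟩ := hπ.exists_affineEquiv_eval hc
  have h1 : ∑ i ∈ Finset.range ((gradingHom s π g).natDegree + 1),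
      c ^ i • (gradingHom s π g).coeff i = σ g := by
    rw [hσe, Polynomial.eval_eq_sum_range]
    refine Finset.sum_congr rfl fun i _ => ?_
    rw [smul_eq_C_mul, C_pow, mul_comm]
  rw [h1]
  obtain ⟨a, ha, hac⟩ := hs c hc
  refine conj_mem_expModule (hH σ hσ) (inv_ne_zero ha) ?_ hg
  apply derivation_ext
  intro i
  rw [conjDer_apply, Derivation.smul_apply, eq_inv_smul_iff₀ ha]
  obtain ⟨x, hx⟩ : ∃ x : affinePolys n K, σ.symm (X i) = x :=
    ⟨⟨_, hσ.symm_map_mem (X_mem_affinePolys i)⟩, rfl⟩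
  have hx' : X i = σ x := by rw [← hx, σ.apply_symm_apply]
  rw [hx, hx', hN, hσe, hσe, hπ.eval_gradingHom, hπ.eval_gradingHom, hN, hac]
  rfl

end IsGrading

/-- The polynomials `c + Tᵈ Q` with `c` a scalar and `Q(0) ∈ W`. -/
def lowOrderSubalgebra {A : Type*} [CommRing A] [Algebra K A] (W : Submodule K A) {d : ℕ}
    (hd : 0 < d) : Subalgebra K (Polynomial A) where
  carrier := {q | ∃ (c : K) (Q : Polynomial A),
    q = Polynomial.C (algebraMap K A c) + Polynomial.X ^ d * Q ∧ Q.coeff 0 ∈ W}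
  mul_mem' := by
    rintro _ _ ⟨c, Q, rfl, hQ⟩ ⟨c', Q', rfl, hQ'⟩
    refine ⟨c * c', Polynomial.C (algebraMap K A c) * Q' + Polynomial.C (algebraMap K A c') * Q +
      Polynomial.X ^ d * Q * Q', ?_, ?_⟩
    · rw [map_mul, map_mul]
      ring
    · rw [Polynomial.coeff_add, Polynomial.coeff_add, Polynomial.coeff_C_mul,
        Polynomial.coeff_C_mul, Polynomial.mul_coeff_zero, Polynomial.mul_coeff_zero,
        Polynomial.coeff_X_pow, if_neg hd.ne, zero_mul, zero_mul, add_zero, ← Algebra.smul_def,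
        ← Algebra.smul_def]
      exact W.add_mem (W.smul_mem _ hQ') (W.smul_mem _ hQ)
  add_mem' := by
    rintro _ _ ⟨c, Q, rfl, hQ⟩ ⟨c', Q', rfl, hQ'⟩
    refine ⟨c + c', Q + Q', ?_, ?_⟩
    · rw [map_add, map_add]
      ring
    · rw [Polynomial.coeff_add]
      exact W.add_mem hQ hQ'
  algebraMap_mem' c := ⟨c, 0, by simp [Polynomial.algebraMap_apply], by simp⟩

theorem coeff_zero_of_mem_lowOrderSubalgebra {A : Type*} [CommRing A] [Algebra K A]
    {W : Submodule K A} {d : ℕ} {hd : 0 < d} {q : Polynomial A}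
    (hq : q ∈ lowOrderSubalgebra W hd) : ∃ c : K, q.coeff 0 = algebraMap K A c := by
  obtain ⟨c, Q, rfl, _⟩ := hq
  refine ⟨c, ?_⟩
  rw [Polynomial.coeff_add, Polynomial.coeff_C_zero, Polynomial.mul_coeff_zero,
    Polynomial.coeff_X_pow, if_neg hd.ne, zero_mul, add_zero]

theorem coeff_mem_of_mem_lowOrderSubalgebra {A : Type*} [CommRing A] [Algebra K A]
    {W : Submodule K A} {d : ℕ} {hd : 0 < d} {q : Polynomial A}
    (hq : q ∈ lowOrderSubalgebra W hd) : q.coeff d ∈ W := by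
  obtain ⟨c, Q, rfl, hQ⟩ := hq
  have := Polynomial.coeff_X_pow_mul Q d 0
  rw [zero_add] at this
  rwa [Polynomial.coeff_add, Polynomial.coeff_C_of_ne_zero hd.ne', zero_add, this]

theorem mem_lowOrderSubalgebra_one {A : Type*} [CommRing A] [Algebra K A]
    {W : Submodule K A} {q : Polynomial A} {c : K} (h0 : q.coeff 0 = algebraMap K A c)
    (h1 : q.coeff 1 ∈ W) : q ∈ lowOrderSubalgebra W Nat.one_pos := by
  refine ⟨c, q.divX, ?_, by rwa [Polynomial.coeff_divX]⟩
  conv_lhs => rw [← Polynomial.X_mul_divX_add q]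
  rw [h0, pow_one, add_comm]

theorem mem_lowOrderSubalgebra_two {A : Type*} [CommRing A] [Algebra K A]
    {W : Submodule K A} {q : Polynomial A} {c : K} (h0 : q.coeff 0 = algebraMap K A c)
    (h1 : q.coeff 1 = 0) (h2 : q.coeff 2 ∈ W) : q ∈ lowOrderSubalgebra W Nat.two_pos := by
  refine ⟨c, q.divX.divX, ?_, by rwa [Polynomial.coeff_divX, Polynomial.coeff_divX]⟩
  have h3 := Polynomial.X_mul_divX_add q.divX
  rw [Polynomial.coeff_divX, zero_add, h1, map_zero, add_zero] at h3
  conv_lhs => rw [← Polynomial.X_mul_divX_add q, ← h3]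
  rw [h0]
  ring

/-! ### Homogeneous elements in the module of an affine derivation -/

/-- Functionals killing `1` correspond to constant vector fields; this turns dual vectors of a
Jordan decomposition into directional derivatives. -/
theorem constDer_apply_of_functional {ζ : affinePolys n K →ₗ[K] K}
    (h1 : ζ ⟨1, one_mem_affinePolys⟩ = 0) (p : affinePolys n K) :
    constDer (fun i => ζ ⟨X i, X_mem_affinePolys i⟩) (p : MvPolynomial (Fin n) K) = C (ζ p) := by
  have : (constDer (fun i => ζ ⟨X i, X_mem_affinePolys i⟩)).toLinearMap ∘ₗ
      (affinePolys n K).subtype = (Algebra.linearMap K (MvPolynomial (Fin n) K)) ∘ₗ ζ := by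
    apply affinePolys_hom_ext
    · change constDer _ 1 = C (ζ _)
      simp [h1]
    · intro i
      exact constDer_X _ _
  exact LinearMap.congr_fun this p

/-- The kernel of `φ ∂_l φ⁻¹` is generated as an algebra by the `φ (X j)` with `j ≠ l`, so a
subalgebra need only be tested on these. -/
theorem mem_of_conjDer_pderiv_eq_zero [CharZero K]
    {φ : MvPolynomial (Fin n) K ≃ₐ[K] MvPolynomial (Fin n) K} {l : Fin n}
    (S : Subalgebra K (MvPolynomial (Fin n) K)) (hS : ∀ j, j ≠ l → φ (X j) ∈ S)
    {f : MvPolynomial (Fin n) K} (hf : conjDer φ (pderiv l) f = 0) : f ∈ S := by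
  have h1 : pderiv l (φ.symm f) = 0 := by
    rw [conjDer_apply] at hf
    exact (map_eq_zero_iff φ φ.injective).1 hf
  have h2 : supported K {j : Fin n | j ≠ l} ≤
      S.comap (φ : MvPolynomial (Fin n) K →ₐ[K] MvPolynomial (Fin n) K) := by
    refine Algebra.adjoin_le ?_
    rintro _ ⟨j, hj, rfl⟩
    exact hS j hj
  have h3 : φ (φ.symm f) ∈ S := h2 (mem_supported_of_pderiv_eq_zero h1)
  rwa [φ.apply_symm_apply] at h3

/-- A derivation without common zero of its values has `1` among its values on polynomials of
degree at most one, if these have degree at most one. -/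
theorem one_mem_range_of_apply_eq_one
    {E : Derivation K (MvPolynomial (Fin n) K) (MvPolynomial (Fin n) K)}
    {N : affinePolys n K →ₗ[K] affinePolys n K} (hN : ∀ p : affinePolys n K, E p = N p)
    {s : MvPolynomial (Fin n) K} (hs : E s = 1) :
    (⟨1, one_mem_affinePolys⟩ : affinePolys n K) ∈ LinearMap.range N := by
  by_contra hcon
  obtain ⟨f, hf, hfN⟩ := Submodule.exists_le_ker_of_notMem hcon
  -- A functional vanishing on the range of `N` and normalized to `1` at `1` is evaluation at the
  -- point `v`. All values of `E` then vanish at `v`, which `E s = 1` forbids.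
  let v : Fin n → K := fun i =>
    (f ⟨1, one_mem_affinePolys⟩)⁻¹ * f ⟨X i, X_mem_affinePolys i⟩
  have hv : ∀ p : affinePolys n K,
      aeval v (p : MvPolynomial (Fin n) K) = (f ⟨1, one_mem_affinePolys⟩)⁻¹ * f p := by
    intro p
    have : (aeval v).toLinearMap ∘ₗ (affinePolys n K).subtype =
        (f ⟨1, one_mem_affinePolys⟩)⁻¹ • f := by
      apply affinePolys_hom_ext
      · change aeval v 1 = _
        simp [hf]
      · intro i
        change aeval v (X i) = _
        rw [aeval_X]
        rfl
    exact LinearMap.congr_fun this p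
  have hE : ∀ g, aeval v (E g) = 0 := by
    intro g
    induction g using MvPolynomial.induction_on with
    | C a => simp
    | add p q hp hq => rw [map_add, map_add, hp, hq, add_zero]
    | mul_X p i hp =>
      have h1 : E (X i) = N ⟨X i, X_mem_affinePolys i⟩ := hN ⟨X i, X_mem_affinePolys i⟩
      have h2 : f (N ⟨X i, X_mem_affinePolys i⟩) = 0 := hfN ⟨_, rfl⟩
      rw [Derivation.leibniz, map_add, smul_eq_mul, smul_eq_mul, map_mul, map_mul, hp, h1, hv, h2]
      ring
  have := hE s
  rw [hs, map_one] at this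
  exact one_ne_zero this

theorem totalDegree_sub_ne_zero {p q : MvPolynomial (Fin n) K} {c : K} (hc : c ≠ 0)
    (hp : p ∈ affinePolys n K) (hq : q.totalDegree ≠ 0) : (p - c • (q * q)).totalDegree ≠ 0 := by
  intro h
  have h1 : p - c • (q * q) ∈ affinePolys n K := mem_affinePolys.2 (by omega)
  have h2 : c • (q * q) ∈ affinePolys n K := by
    have := Submodule.sub_mem _ hp h1
    rwa [sub_sub_cancel] at this
  exact mul_notMem_affinePolys hq hq ((Submodule.smul_mem_iff _ hc).1 h2)

theorem totalDegree_ne_zero_of_apply_ne_zero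
    {E : Derivation K (MvPolynomial (Fin n) K) (MvPolynomial (Fin n) K)}
    {p : MvPolynomial (Fin n) K} (h : E p ≠ 0) : p.totalDegree ≠ 0 := by
  intro h0
  rw [totalDegree_eq_zero_iff_eq_C] at h0
  rw [h0, derivation_C] at h
  exact h rfl

/-- The chain, containing `1`, has degree zero and the complement degree one. `N` preserves this
grading if it kills `1`, by `map_compl`. -/
theorem JordanChain.isGrading_compl {N : affinePolys n K →ₗ[K] affinePolys n K}
    (J : JordanChain N ⟨1, one_mem_affinePolys⟩) :
    IsGrading 2 (fun j => if j = 0 then LinearMap.id - J.compl else J.compl) where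
  sum_apply x := by simp [Finset.sum_range_succ]
  apply_apply i j hi hj x := by
    interval_cases i <;> interval_cases j <;> simp [J.compl_compl]
  apply_one j hj := by
    have h0 : J.compl ⟨1, one_mem_affinePolys⟩ = 0 := by
      have := J.compl_w (Nat.zero_le _)
      rwa [J.w_zero] at this
    interval_cases j <;> simp [h0]
  pos := by norm_num

/-- The vector `J.w j` has degree `j`; `N` lowers degrees by one if it kills `1`, so weighted
scalings rescale it. -/
theorem JordanChain.isGrading_proj {N : affinePolys n K →ₗ[K] affinePolys n K}
    (J : JordanChain N ⟨1, one_mem_affinePolys⟩)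
    (h : J.compl = 0) : IsGrading (J.k + 1) J.proj where
  sum_apply x := by
    have := J.compl_apply x
    rw [h, LinearMap.zero_apply] at this
    exact (sub_eq_zero.1 this.symm).symm
  apply_apply i j hi hj x := by
    rw [J.proj_apply (j := j) (by omega), map_smul, J.proj_w i (by omega)]
    split_ifs <;> simp
  apply_one j hj := by
    have := J.proj_w j (Nat.zero_le _)
    rwa [J.w_zero] at this
  pos := by omega

/-! ### Affine derivations with non-constant coefficients -/

section Nonconstant

variable [CharZero K]
  {H : Subgroup (MvPolynomial (Fin n) K ≃ₐ[K] MvPolynomial (Fin n) K)}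
  (hH : ∀ σ, IsAffineEquiv σ → σ ∈ H)
  {φ : MvPolynomial (Fin n) K ≃ₐ[K] MvPolynomial (Fin n) K} (hφ : φ ∈ H) {l : Fin n}
  {E : Derivation K (MvPolynomial (Fin n) K) (MvPolynomial (Fin n) K)}
  (hE : IsLocallyNilpotent E) (hφE : conjDer φ (pderiv l) = E)
  {N : affinePolys n K →ₗ[K] affinePolys n K} (hN : ∀ p : affinePolys n K, E p = N p)
  (J : JordanChain N ⟨1, one_mem_affinePolys⟩)

include hH hφ hφE hN

/-- The field `u` comes from a functional supported on the complement, so it kills all degree-zero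
components. If some `φ (X j)` with `j ≠ l` has a non-constant degree-zero component, that is `g`. If
not, kernel elements of `E` have constant degree-zero part, and their degree-one part lies in the
module. For `J.k = 1` this puts a suitable element of the complement in the module; longer chains
give a contradiction. -/
theorem exists_mem_expModule_of_compl_ne_zero (hNnil : IsNilpotent N) (h : J.compl ≠ 0)
    (hNE : ∃ x, ∀ c : K, N x ≠ c • ⟨1, one_mem_affinePolys⟩) :
    ∃ u : Fin n → K, u ≠ 0 ∧ (∀ i, constDer u (E (X i)) = 0) ∧
      ∃ g ∈ expModule H hE, g.totalDegree ≠ 0 ∧ constDer u g = 0 := by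
  have hN1 : N ⟨1, one_mem_affinePolys⟩ = 0 := by
    apply Subtype.ext
    rw [← hN]
    simp
  obtain ⟨ζ, hζ, hζN, hζc⟩ := J.exists_functional hNnil hN1 h
  have hζ1 : ζ ⟨1, one_mem_affinePolys⟩ = 0 := by
    rw [← J.w_zero, ← J.map_w_succ 0 J.one_le, hζN]
  have hu := constDer_apply_of_functional hζ1
  set u : Fin n → K := fun i => ζ ⟨X i, X_mem_affinePolys i⟩ with hudef
  refine ⟨u, fun h0 => hζ (affinePolys_hom_ext hζ1 fun i => congrFun h0 i), fun i => ?_, ?_⟩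
  · have := hN ⟨X i, X_mem_affinePolys i⟩
    change E (X i) = _ at this
    rw [this, hu, hζN, map_zero]
  have hπ := J.isGrading_compl
  set π : ℕ → affinePolys n K →ₗ[K] affinePolys n K :=
    fun j => if j = 0 then LinearMap.id - J.compl else J.compl with hπdef
  have hcoeff : ∀ g ∈ expModule H hE, ∀ d, (gradingHom 2 π g).coeff d ∈ expModule H hE := by
    intro g hg d
    refine hπ.coeff_gradingHom_mem hH hE N hN (fun c _ => ⟨1, one_ne_zero, fun x => ?_⟩) hg d
    simp [Finset.sum_range_succ, π, J.map_compl hN1]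
  have hu0 : ∀ f, constDer u ((gradingHom 2 π f).coeff 0) = 0 := by
    intro f
    induction f using MvPolynomial.induction_on with
    | C a => simp [Polynomial.algebraMap_apply]
    | add p q hp hq => rw [map_add, Polynomial.coeff_add, map_add, hp, hq, add_zero]
    | mul_X p i hp =>
      have h1 : (gradingHom 2 π (X i)).coeff 0 = (π 0 ⟨X i, X_mem_affinePolys i⟩ : _) := by
        have := hπ.gradingHom_apply ⟨X i, X_mem_affinePolys i⟩
        change gradingHom 2 π (X i) = _ at this
        rw [this]
        simp [Finset.sum_range_succ]
      have h2 : constDer u ((gradingHom 2 π (X i)).coeff 0) = 0 := by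
        rw [h1, hu]
        simp [π, hζc]
      rw [map_mul, Polynomial.mul_coeff_zero, Derivation.leibniz, hp, h2, smul_zero, smul_zero,
        add_zero]
  have hgen : ∀ j, j ≠ l → φ (X j) ∈ expModule H hE := fun j hj =>
    map_mem_expModule_conjDer hH hφ hE hφE (X_mem_affinePolys j) (pderiv_X_of_ne hj)
  by_cases hcase : ∃ j, j ≠ l ∧ ((gradingHom 2 π (φ (X j))).coeff 0).totalDegree ≠ 0
  · obtain ⟨j, hj, hdeg⟩ := hcase
    exact ⟨_, hcoeff _ (hgen j hj) 0, hdeg, hu0 _⟩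
  push Not at hcase
  have hker : ∀ f, E f = 0 → gradingHom 2 π f ∈ lowOrderSubalgebra (expModule H hE) one_pos := by
    intro f hf
    rw [← hφE] at hf
    refine mem_of_conjDer_pderiv_eq_zero
      ((lowOrderSubalgebra (expModule H hE) one_pos).comap (gradingHom 2 π)) (fun j hj => ?_) hf
    exact mem_lowOrderSubalgebra_one (totalDegree_eq_zero_iff_eq_C.1 (hcase j hj))
      (hcoeff _ (hgen j hj) 1)
  by_cases hk : J.k = 1
  · obtain ⟨x, hx⟩ := hNE
    obtain ⟨y, hy, hy'⟩ := J.exists_mem_ker hNnil hN1 hk hx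
    -- `m` is homogeneous of degree one and in the kernel, so it equals the component that `hker`
    -- places in the module.
    set m := J.compl (N y) with hm
    have hm1 : π 1 m = m := J.compl_compl _
    have hEm : E m = 0 := by rw [hN, hy']; rfl
    have h1 := coeff_mem_of_mem_lowOrderSubalgebra (hker m hEm)
    rw [hπ.gradingHom_eq_of_proj_eq one_lt_two hm1, Polynomial.coeff_C_mul, pow_one,
      Polynomial.coeff_X_one, mul_one] at h1
    refine ⟨m, h1, fun hdeg => hy ?_, ?_⟩
    · rw [totalDegree_eq_zero_iff_eq_C] at hdeg
      set c := coeff 0 (m : MvPolynomial (Fin n) K)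
      have h2 : m = c • J.w 0 := by
        apply Subtype.ext
        rw [hdeg, J.w_zero, C_eq_smul_one]
        rfl
      have h3 : J.compl m = m := J.compl_compl _
      exact h3.symm.trans (by rw [h2, map_smul, J.compl_w (Nat.zero_le _), smul_zero])
    · rw [hu, hm, hζc, hζN, map_zero]
  · exfalso
    have h1k := J.one_le
    have hfix : ∀ j, j ≤ J.k → gradingHom 2 π (J.w j : MvPolynomial (Fin n) K) =
        Polynomial.C (J.w j : MvPolynomial (Fin n) K) := by
      intro j hj
      have : π 0 (J.w j) = J.w j := by simp [π, J.compl_w hj]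
      rw [hπ.gradingHom_eq_of_proj_eq two_pos this, pow_zero, mul_one]
    have hE1 : E (J.w 1) = 1 := by
      rw [hN, J.map_w_succ 0 J.one_le, J.w_zero]
    have hE2 : E (J.w 2) = J.w 1 := by
      rw [hN, J.map_w_succ 1 (by omega)]
    -- A non-constant kernel element built from the chain alone: it has degree zero, contrary to
    -- `hker`.
    set f : MvPolynomial (Fin n) K := (J.w 2 : MvPolynomial (Fin n) K) -
      (2 : K)⁻¹ • ((J.w 1 : MvPolynomial (Fin n) K) * J.w 1) with hf
    have hEf : E f = 0 := by
      rw [hf, map_sub, Derivation.map_smul, Derivation.leibniz, hE1, hE2, smul_eq_mul, mul_one,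
        ← two_smul K, smul_smul, inv_mul_cancel₀ two_ne_zero, one_smul, sub_self]
    obtain ⟨c, hc⟩ := coeff_zero_of_mem_lowOrderSubalgebra (hker f hEf)
    rw [hf, map_sub, map_smul, map_mul, hfix 1 J.one_le, hfix 2 (by omega), ← Polynomial.C_mul,
      Polynomial.smul_C, ← Polynomial.C_sub, Polynomial.coeff_C_zero] at hc
    refine totalDegree_sub_ne_zero (c := (2 : K)⁻¹) (inv_ne_zero two_ne_zero) (J.w 2).2
      (totalDegree_ne_zero_of_apply_ne_zero (E := E) (by rw [hE1]; exact one_ne_zero)) ?_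
    rw [hc]
    exact totalDegree_C _

/-- The Jordan chain spans, with `J.w j` in degree `j`. The generators `φ (X j)`, `j ≠ l`, of the
kernel have constant degree-zero part, no degree-one part, and degree-two part in the module. These
conditions pass to the whole kernel, in particular to the homogeneous element `w₂ - w₁² / 2` of
degree two, which is `g`. -/
theorem exists_mem_expModule_of_compl_eq_zero (hn : 3 ≤ n) (h : J.compl = 0) :
    ∃ u : Fin n → K, u ≠ 0 ∧ (∀ i, constDer u (E (X i)) = 0) ∧
      ∃ g ∈ expModule H hE, g.totalDegree ≠ 0 ∧ constDer u g = 0 := by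
  -- The affine polynomials have dimension greater than `n`, so `J.k ≥ n`. The bound puts `J.w 1`
  -- and `J.w 2` below the top vector, where the functional `ζ` vanishes.
  have hk : 3 ≤ J.k := by
    have h1 := J.finrank_le_of_compl_eq_zero h
    have h2 := lt_finrank_affinePolys (n := n) (K := K)
    omega
  have hN1 : N ⟨1, one_mem_affinePolys⟩ = 0 := by
    apply Subtype.ext
    rw [← hN]
    simp
  let ζ : affinePolys n K →ₗ[K] K := J.l ∘ₗ (N ^ J.k)
  have hζw : ∀ j, j ≤ J.k → ζ (J.w j) = if J.k = j then 1 else 0 := fun j hj =>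
    J.l_pow_w J.k j hj
  have hζN : ∀ x, ζ (N x) = 0 := by
    intro x
    have := J.l_pow_succ x
    rwa [pow_succ, Module.End.mul_apply] at this
  have hζ1 : ζ ⟨1, one_mem_affinePolys⟩ = 0 := by
    rw [← J.w_zero, ← J.map_w_succ 0 J.one_le, hζN]
  have hζ : ζ ≠ 0 := by
    intro h0
    have := hζw J.k le_rfl
    rw [h0, if_pos rfl] at this
    exact zero_ne_one this
  have hu := constDer_apply_of_functional hζ1
  set u : Fin n → K := fun i => ζ ⟨X i, X_mem_affinePolys i⟩ with hudef
  refine ⟨u, fun h0 => hζ (affinePolys_hom_ext hζ1 fun i => congrFun h0 i), fun i => ?_, ?_⟩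
  · have := hN ⟨X i, X_mem_affinePolys i⟩
    change E (X i) = _ at this
    rw [this, hu, hζN, map_zero]
  have hπ := J.isGrading_proj h
  have hcoeff : ∀ g ∈ expModule H hE, ∀ d,
      (gradingHom (J.k + 1) J.proj g).coeff d ∈ expModule H hE := by
    intro g hg d
    refine hπ.coeff_gradingHom_mem hH hE N hN (fun c hc => ⟨c, hc, fun x => ?_⟩) hg d
    rw [map_sum, Finset.sum_range_succ', Finset.sum_range_succ _ J.k]
    simp only [map_smul, J.map_proj_succ, J.map_proj_zero hN1, smul_zero, add_zero]
    have h0 : J.proj J.k (N x) = 0 := by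
      rw [← J.map_proj_succ, JordanChain.proj, if_neg (by omega)]
      simp
    rw [h0, smul_zero, add_zero, Finset.smul_sum]
    refine Finset.sum_congr rfl fun j _ => ?_
    rw [smul_smul, pow_succ']
  have hw : ∀ j, j ≤ J.k → gradingHom (J.k + 1) J.proj (J.w j : MvPolynomial (Fin n) K) =
      Polynomial.C (J.w j : MvPolynomial (Fin n) K) * Polynomial.X ^ j := fun j hj =>
    hπ.gradingHom_eq_of_proj_eq (by omega) (by rw [J.proj_w j hj, if_pos rfl])
  have hE1 : E (J.w 1) = 1 := by
    rw [hN, J.map_w_succ 0 J.one_le, J.w_zero]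
  have hE2 : E (J.w 2) = J.w 1 := by
    rw [hN, J.map_w_succ 1 (by omega)]
  have hlow : ∀ f, gradingHom (J.k + 1) J.proj f ∈
      lowOrderSubalgebra (K ∙ (J.w 1 : MvPolynomial (Fin n) K)) one_pos := by
    intro f
    have hX : ∀ i, gradingHom (J.k + 1) J.proj (X i) ∈
        lowOrderSubalgebra (K ∙ (J.w 1 : MvPolynomial (Fin n) K)) one_pos := by
      intro i
      have h1 := hπ.gradingHom_apply ⟨X i, X_mem_affinePolys i⟩
      change gradingHom (J.k + 1) J.proj (X i) = _ at h1
      have h2 : ∀ d, d ≤ J.k → (gradingHom (J.k + 1) J.proj (X i)).coeff d =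
          J.proj d ⟨X i, X_mem_affinePolys i⟩ := by
        intro d hd
        rw [h1, Polynomial.finsetSum_coeff, Finset.sum_eq_single d]
        · simp
        · intro j _ hj
          simp [Polynomial.coeff_X_pow, Ne.symm hj]
        · intro h
          exact absurd (Finset.mem_range.2 (by omega)) h
      refine mem_lowOrderSubalgebra_one
        (c := J.l ((N ^ 0) ⟨X i, X_mem_affinePolys i⟩)) ?_ ?_
      · rw [h2 0 (by omega), J.proj_apply (by omega), J.w_zero, Submodule.coe_smul,
          Algebra.algebraMap_eq_smul_one]
      · rw [h2 1 (by omega), J.proj_apply (by omega), Submodule.coe_smul]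
        exact Submodule.smul_mem _ _ (Submodule.mem_span_singleton_self _)
    have h1 : (⊤ : Subalgebra K (MvPolynomial (Fin n) K)) ≤
        (lowOrderSubalgebra (K ∙ (J.w 1 : MvPolynomial (Fin n) K)) one_pos).comap
          (gradingHom (J.k + 1) J.proj) := by
      rw [← MvPolynomial.adjoin_range_X]
      refine Algebra.adjoin_le ?_
      rintro _ ⟨i, rfl⟩
      exact hX i
    exact h1 Algebra.mem_top
  have hgen : ∀ j, j ≠ l → φ (X j) ∈ expModule H hE := fun j hj =>
    map_mem_expModule_conjDer hH hφ hE hφE (X_mem_affinePolys j) (pderiv_X_of_ne hj)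
  set f : MvPolynomial (Fin n) K := (J.w 2 : MvPolynomial (Fin n) K) -
    (2 : K)⁻¹ • ((J.w 1 : MvPolynomial (Fin n) K) * J.w 1) with hf
  have hEf : E f = 0 := by
    rw [hf, map_sub, Derivation.map_smul, Derivation.leibniz, hE1, hE2, smul_eq_mul, mul_one,
      ← two_smul K, smul_smul, inv_mul_cancel₀ two_ne_zero, one_smul, sub_self]
  have hmem : gradingHom (J.k + 1) J.proj f ∈
      lowOrderSubalgebra (expModule H hE) two_pos := by
    have hEf' := hEf
    rw [← hφE] at hEf'
    refine mem_of_conjDer_pderiv_eq_zero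
      ((lowOrderSubalgebra (expModule H hE) two_pos).comap (gradingHom (J.k + 1) J.proj))
      (fun j hj => ?_) hEf'
    obtain ⟨c, hc⟩ := coeff_zero_of_mem_lowOrderSubalgebra (hlow (φ (X j)))
    refine mem_lowOrderSubalgebra_two hc ?_ (hcoeff _ (hgen j hj) 2)
    -- The degree-one part is `a • J.w 1` and lies in the kernel, being in the module; since `E (J.w
    -- 1) = 1`, `a = 0`.
    obtain ⟨a, ha⟩ := Submodule.mem_span_singleton.1
      (coeff_mem_of_mem_lowOrderSubalgebra (hlow (φ (X j))))
    have h1 := (hcoeff _ (hgen j hj) 1).1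
    rw [← ha, Derivation.map_smul, hE1, smul_eq_zero] at h1
    change (gradingHom (J.k + 1) J.proj (φ (X j))).coeff 1 = 0
    rw [← ha, h1.resolve_right one_ne_zero, zero_smul]
  have hΘf : gradingHom (J.k + 1) J.proj f = Polynomial.C f * Polynomial.X ^ 2 := by
    rw [hf, map_sub, map_smul, map_mul, hw 1 (by omega), hw 2 (by omega), Polynomial.C_sub,
      ← Polynomial.smul_C, Polynomial.C_mul, sub_mul, smul_mul_assoc]
    ring_nf
  refine ⟨f, ?_, ?_, ?_⟩
  · have h1 := coeff_mem_of_mem_lowOrderSubalgebra hmem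
    rwa [hΘf, Polynomial.coeff_C_mul, Polynomial.coeff_X_pow, if_pos rfl, mul_one] at h1
  · exact totalDegree_sub_ne_zero (inv_ne_zero two_ne_zero) (J.w 2).2
      (totalDegree_ne_zero_of_apply_ne_zero (E := E) (by rw [hE1]; exact one_ne_zero))
  · have hu1 : constDer u (J.w 1 : MvPolynomial (Fin n) K) = 0 := by
      rw [hu, hζw 1 (by omega), if_neg (by omega), map_zero]
    have hu2 : constDer u (J.w 2 : MvPolynomial (Fin n) K) = 0 := by
      rw [hu, hζw 2 (by omega), if_neg (by omega), map_zero]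
    rw [hf, map_sub, Derivation.map_smul, Derivation.leibniz, hu1, hu2]
    simp

end Nonconstant

theorem IsCoTame.of_mem {φ φ' : GA n K} (h : IsCoTame φ')
    (hmem : φ' ∈ Subgroup.closure ({φ} ∪ {α | IsAffine α})) : IsCoTame φ := by
  refine h.trans ((Subgroup.closure_le _).2 ?_)
  rintro σ (rfl | hσ)
  · exact hmem
  · exact Subgroup.subset_closure (Or.inr hσ)

/-- No `D (X i)` involves the last variable and every `∂_n x_i` is constant, so the commutator kills
all variables. -/
theorem IsTriangularDerivation.commute_pderiv [NeZero n]
    {D : Derivation K (MvPolynomial (Fin n) K) (MvPolynomial (Fin n) K)}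
    (hD : IsTriangularDerivation D) (f : MvPolynomial (Fin n) K) :
    D (pderiv (lastIndex n) f) = pderiv (lastIndex n) (D f) := by
  have h : ⁅D, pderiv (R := K) (lastIndex n)⁆ = 0 := by
    apply derivation_ext
    intro i
    have hi : i ≤ lastIndex n := Nat.le_sub_one_of_lt i.2
    rw [Derivation.commutator_apply, pderiv_eq_zero_of_mem_lowerPolys hi (hD i), sub_zero,
      Derivation.zero_apply]
    by_cases h : i = lastIndex n
    · rw [h, pderiv_X_self, Derivation.map_one_eq_zero]
    · rw [pderiv_X_of_ne h, map_zero]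
  have := DFunLike.congr_fun h f
  rw [Derivation.commutator_apply] at this
  exact sub_eq_zero.1 this

/-! ### The Nagata automorphism -/

/-- The derivation `x₁ ∂₂ - 2 x₂ ∂₃`. -/
def nagataDerivation (K : Type*) [Field K] :
    Derivation K (MvPolynomial (Fin 3) K) (MvPolynomial (Fin 3) K) :=
  mkDerivation K ![0, X 0, -2 * X 1]

theorem nagataDerivation_X_zero : nagataDerivation K (X 0) = 0 := mkDerivation_X _ _ _

theorem nagataDerivation_X_one : nagataDerivation K (X 1) = X 0 := mkDerivation_X _ _ _

theorem nagataDerivation_X_two : nagataDerivation K (X 2) = -2 * X 1 := mkDerivation_X _ _ _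

theorem nagataDerivation_mul_X_one : nagataDerivation K (-2 * X 1) = -2 * X 0 := by
  have h : (-2 * X 1 : MvPolynomial (Fin 3) K) = (-2 : K) • X 1 := by
    rw [smul_eq_C_mul, map_neg]
    rfl
  rw [h, Derivation.map_smul, nagataDerivation_X_one, smul_eq_C_mul, map_neg]
  rfl

theorem nagataDerivation_mul_X_zero : nagataDerivation K (-2 * X 0) = 0 := by
  rw [← nagataDerivation_mul_X_one, nagataDerivation_mul_X_one]
  have h : (-2 * X 0 : MvPolynomial (Fin 3) K) = (-2 : K) • X 0 := by
    rw [smul_eq_C_mul, map_neg]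
    rfl
  rw [h, Derivation.map_smul, nagataDerivation_X_zero, smul_zero]

theorem nagataDerivation_iterate (i : Fin 3) : (nagataDerivation K)^[3] (X i) = 0 := by
  fin_cases i
  · simp [nagataDerivation_X_zero]
  · simp [nagataDerivation_X_zero, nagataDerivation_X_one]
  · change nagataDerivation K (nagataDerivation K (nagataDerivation K (X 2))) = 0
    rw [nagataDerivation_X_two, nagataDerivation_mul_X_one, nagataDerivation_mul_X_zero]

theorem isLocallyNilpotent_nagataDerivation [CharZero K] : IsLocallyNilpotent (nagataDerivation K) :=
  isLocallyNilpotent_of_X fun i => ⟨3, nagataDerivation_iterate i⟩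

theorem isTriangularDerivation_nagataDerivation :
    IsTriangularDerivation (nagataDerivation K) := by
  intro i
  fin_cases i
  · change nagataDerivation K (X 0) ∈ _
    rw [nagataDerivation_X_zero]
    exact Subalgebra.zero_mem _
  · change nagataDerivation K (X 1) ∈ lowerPolys K (1 : Fin 3)
    rw [nagataDerivation_X_one]
    exact X_mem_supported.2 (show (0 : Fin 3) < 1 by decide)
  · change nagataDerivation K (X 2) ∈ lowerPolys K (2 : Fin 3)
    rw [nagataDerivation_X_two]
    refine Subalgebra.mul_mem _ (Subalgebra.neg_mem _ ?_)
      (X_mem_supported.2 (show (1 : Fin 3) < 2 by decide))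
    exact Subalgebra.algebraMap_mem _ (2 : K)

theorem nagataDerivation_apply_eq_zero :
    nagataDerivation K (X 0 * X 2 + X 1 ^ 2 : MvPolynomial (Fin 3) K) = 0 := by
  rw [map_add, Derivation.leibniz, Derivation.leibniz_pow, nagataDerivation_X_zero,
    nagataDerivation_X_one, nagataDerivation_X_two]
  simp only [smul_eq_mul, nsmul_eq_mul]
  push_cast
  ring

theorem component_expGA_nagataDerivation [CharZero K] (i : Fin 3) :
    (expGA ((X 0 * X 2 + X 1 ^ 2 : MvPolynomial (Fin 3) K) • nagataDerivation K)
      (isLocallyNilpotent_nagataDerivation.smul_of_mem_ker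
        nagataDerivation_apply_eq_zero)).component i = nagataComponents K i := by
  change expFun _ (X i) = _
  rw [expFun_smul_of_mem_ker nagataDerivation_apply_eq_zero (nagataDerivation_iterate i)]
  simp only [Finset.sum_range_succ, Finset.sum_range_zero, Function.iterate_succ_apply',
    Function.iterate_zero_apply, zero_add, pow_zero, pow_one, one_mul, Nat.factorial_zero,
    Nat.factorial_one, Nat.cast_one, inv_one, one_smul, Nat.factorial_two]
  fin_cases i
  · change X 0 + _ * nagataDerivation K (X 0) +
      _ • (_ * nagataDerivation K (nagataDerivation K (X 0))) = X 0
    simp [nagataDerivation_X_zero]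
  · change X 1 + _ * nagataDerivation K (X 1) +
      _ • (_ * nagataDerivation K (nagataDerivation K (X 1))) = X 1 + X 0 * (X 0 * X 2 + X 1 ^ 2)
    rw [nagataDerivation_X_one, nagataDerivation_X_zero, mul_zero, smul_zero, add_zero, mul_comm]
  · change X 2 + _ * nagataDerivation K (X 2) +
      _ • (_ * nagataDerivation K (nagataDerivation K (X 2))) =
      X 2 - 2 * X 1 * (X 0 * X 2 + X 1 ^ 2) - X 0 * (X 0 * X 2 + X 1 ^ 2) ^ 2
    rw [nagataDerivation_X_two, nagataDerivation_mul_X_one]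
    have h : (2 : MvPolynomial (Fin 3) K) = C (2 : K) := rfl
    have h2 : ∀ p : MvPolynomial (Fin 3) K,
        (((2 : ℕ) : K)⁻¹) • (p * (-2 * X 0)) = -(X 0 * p) := by
      intro p
      rw [h, smul_eq_C_mul]
      have h3 : C (((2 : ℕ) : K)⁻¹) * C (2 : K) = (1 : MvPolynomial (Fin 3) K) := by
        rw [← C_mul, Nat.cast_ofNat, inv_mul_cancel₀ two_ne_zero, C_1]
      linear_combination -(p * X 0) * h3
    rw [h2]
    ring

/-- The second component differs from `x₂` by a product of two non-constant polynomials. -/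
theorem not_isAffine_of_component_eq_nagataComponents {φ : GA 3 K}
    (h : ∀ i, φ.component i = nagataComponents K i) : ¬ IsAffine φ := by
  intro hφ
  have h1 : φ.component 1 ∈ affinePolys 3 K := mem_affinePolys.2 (hφ 1).le
  have h2 : φ.component 1 = X 1 + X 0 * (X 0 * X 2 + X 1 ^ 2) := h 1
  have h3 := Submodule.sub_mem _ h1 (X_mem_affinePolys 1)
  rw [h2, add_sub_cancel_left] at h3
  refine mul_notMem_affinePolys (by simp) (totalDegree_ne_zero_of_apply_ne_zero
    (E := pderiv 2) ?_) h3
  have : pderiv 2 (X 0 * X 2 + X 1 ^ 2 : MvPolynomial (Fin 3) K) = X 0 := by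
    simp [pderiv_X_of_ne (show (0 : Fin 3) ≠ 2 by decide),
      pderiv_X_of_ne (show (1 : Fin 3) ≠ 2 by decide)]
  rw [this]
  exact X_ne_zero 0

/-! ### Co-tameness of automorphisms that conjugate translations to affine automorphisms -/

variable [CharZero K]

/-- If `φ ∂_l φ⁻¹` has affine coefficients, the group generated by the affine automorphisms and the
non-affine `φ` contains the triangular automorphisms. -/
theorem triangular_mem_of_conj_pderiv_affine (hn : 3 ≤ n)
    {H : Subgroup (MvPolynomial (Fin n) K ≃ₐ[K] MvPolynomial (Fin n) K)}
    (hH : ∀ σ, IsAffineEquiv σ → σ ∈ H) {φ : MvPolynomial (Fin n) K ≃ₐ[K] MvPolynomial (Fin n) K}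
    (hφ : φ ∈ H) (hna : ¬ IsAffineEquiv φ) {l : Fin n}
    (hEL : ∀ i, conjDer φ (pderiv l) (X i) ∈ affinePolys n K)
    {σ : MvPolynomial (Fin n) K ≃ₐ[K] MvPolynomial (Fin n) K}
    (hσ : ∀ i, ∃ u : Kˣ, ∃ P ∈ lowerPolys K i, σ (X i) = C (u : K) * X i + P) : σ ∈ H := by
  obtain ⟨E, hφE⟩ : ∃ E, conjDer φ (pderiv l) = E := ⟨_, rfl⟩
  have hE : IsLocallyNilpotent E := hφE ▸ (isLocallyNilpotent_pderiv l).conjDer φ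
  rw [hφE] at hEL
  by_cases hconst : ∀ i, (E (X i)).totalDegree = 0
  · refine triangular_mem_of_conj_pderiv_eq_constDer hn hH hφ hna (l := l)
      (u := fun i => coeff 0 (E (X i))) ?_ hσ
    rw [hφE]
    apply derivation_ext
    intro i
    rw [constDer_X]
    exact totalDegree_eq_zero_iff_eq_C.1 (hconst i)
  push Not at hconst
  obtain ⟨i₀, hi₀⟩ := hconst
  let N : affinePolys n K →ₗ[K] affinePolys n K := E.toLinearMap.restrict fun p hp =>
    map_affinePolys_le (f := E.toLinearMap) (by
      change E 1 ∈ _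
      rw [Derivation.map_one_eq_zero]
      exact Submodule.zero_mem _) hEL hp
  have hN : ∀ p : affinePolys n K, E p = N p := fun p => rfl
  have hNi : ∀ i (p : affinePolys n K), (((N ^ i) p : affinePolys n K) : MvPolynomial (Fin n) K) =
      E^[i] p := by
    intro i p
    induction i with
    | zero => rfl
    | succ i ih => rw [pow_succ', Module.End.mul_apply, ← hN, ih, Function.iterate_succ_apply']
  have hNnil : IsNilpotent N := by
    rw [Module.End.isNilpotent_iff_of_finite]
    intro p
    obtain ⟨m, hm⟩ := hE (p : MvPolynomial (Fin n) K)
    exact ⟨m, Subtype.ext (by rw [hNi, hm]; rfl)⟩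
  have hE1 : E (φ (X l)) = 1 := by
    rw [← hφE, conjDer_map, pderiv_X_self, map_one]
  obtain ⟨J⟩ := exists_jordanChain hNnil (e := ⟨1, one_mem_affinePolys⟩)
    (fun h => one_ne_zero (congrArg Subtype.val h))
    (Subtype.ext (by rw [← hN]; exact Derivation.map_one_eq_zero E))
    (one_mem_range_of_apply_eq_one hN hE1)
  have hNE : ∃ x, ∀ c : K, N x ≠ c • ⟨1, one_mem_affinePolys⟩ := by
    refine ⟨⟨X i₀, X_mem_affinePolys i₀⟩, fun c hc => hi₀ ?_⟩
    have h1 : E (X i₀) = c • 1 := congrArg Subtype.val hc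
    rw [h1, ← C_eq_smul_one, totalDegree_C]
  obtain ⟨u, hu, huE, g, hg, hgdeg, hug⟩ : ∃ u : Fin n → K, u ≠ 0 ∧
      (∀ i, constDer u (E (X i)) = 0) ∧
      ∃ g ∈ expModule H hE, g.totalDegree ≠ 0 ∧ constDer u g = 0 := by
    by_cases h : J.compl = 0
    · exact exists_mem_expModule_of_compl_eq_zero hH hφ hE hφE hN J hn h
    · exact exists_mem_expModule_of_compl_ne_zero hH hφ hE hφE hN J hNnil h hNE
  -- Were all these values affine, so would be the coefficient of `c`, namely `g * E (X i₀)`, a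
  -- product of two non-constant polynomials. The length `M + 2` ensures that this coefficient
  -- appears in the sum.
  obtain ⟨c, hc⟩ : ∃ c : K, ¬ ∀ i, expFun ((c • g) • E) (X i) ∈ affinePolys n K := by
    by_contra hcon
    push Not at hcon
    obtain ⟨M, hM⟩ := hE (X i₀)
    have hM' : E^[M + 2] (X i₀) = 0 := iterate_zero_of_le hM (by omega)
    have h1 := mem_of_forall_sum_pow_smul_mem (affinePolys n K) (N := M + 2)
      (a := fun i => ((i.factorial : K)⁻¹) • (g ^ i * E^[i] (X i₀))) (fun c _ => by
        rw [← expFun_const_smul c hg.1 hM']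
        exact hcon c i₀) (i := 1) (by omega)
    refine mul_notMem_affinePolys hgdeg hi₀ ?_
    simpa using h1
  have hcg : E (c • g) = 0 := by rw [Derivation.map_smul, hg.1, smul_zero]
  have hLN := hE.smul_of_mem_ker hcg
  have hρH : expAlgEquiv ((c • g) • E) hLN ∈ H := expAlgEquiv_mem (Submodule.smul_mem _ c hg) hLN
  obtain ⟨β, hβ, hβu⟩ := exists_affineEquiv_conj_pderiv l hu
  -- The exponential commutes with `constDer u`, so its product with `β` still conjugates `∂_l` to
  -- `constDer u`.
  refine triangular_mem_of_conj_pderiv_eq_constDer hn hH (l := l) (u := u)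
    (H.mul_mem hρH (hH β hβ)) (fun hcon => hc ?_) ?_ hσ
  · have h1 := hcon.mul hβ.inv
    rw [mul_inv_cancel_right] at h1
    exact h1
  · rw [conjDer_mul, hβu, conjDer_eq_iff]
    intro f
    refine (map_expFun hLN (constDer u).toLinearMap (fun f => ?_) f).symm
    have hbr : ⁅constDer u, E⁆ = 0 := by
      apply derivation_ext
      intro i
      rw [Derivation.commutator_apply, huE, constDer_X, derivation_C, sub_zero,
        Derivation.zero_apply]
    have h2 : constDer u (E f) = E (constDer u f) := by
      have := DFunLike.congr_fun hbr f
      rw [Derivation.commutator_apply] at this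
      exact sub_eq_zero.1 this
    change constDer u ((c • g) • E f) = (c • g) • E (constDer u f)
    rw [smul_eq_mul, Derivation.leibniz, Derivation.map_smul, hug, smul_zero, smul_zero, add_zero,
      h2]

/-! ### Translations and parabolic automorphisms -/

/-- The translation of the coordinate `x_l` by `c`. -/
def translation (l : Fin n) (c : K) : MvPolynomial (Fin n) K ≃ₐ[K] MvPolynomial (Fin n) K :=
  expAlgEquiv ((c • (1 : MvPolynomial (Fin n) K)) • pderiv (R := K) l)
    ((isLocallyNilpotent_pderiv l).smul_of_mem_ker (by simp))

theorem translation_apply (l : Fin n) (c : K) (f : MvPolynomial (Fin n) K) :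
    translation l c f = expFun ((c • (1 : MvPolynomial (Fin n) K)) • pderiv (R := K) l) f := rfl

theorem translation_X (l : Fin n) (c : K) (i : Fin n) :
    translation l c (X i) = if i = l then X i + C c else X i := by
  have h : pderiv l (c • (1 : MvPolynomial (Fin n) K)) = 0 := by simp
  rw [translation_apply]
  split_ifs with hi
  · subst hi
    rw [expFun_smul_pderiv_X_self h, C_eq_smul_one]
  · rw [expFun_smul_pderiv_of_eq_zero h (pderiv_X_of_ne hi)]

theorem isAffineEquiv_translation (l : Fin n) (c : K) : IsAffineEquiv (translation l c) := by
  intro i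
  rw [translation_X]
  split_ifs
  · exact Submodule.add_mem _ (X_mem_affinePolys _) (C_mem_affinePolys _)
  · exact X_mem_affinePolys _

theorem mem_translationSubgroup_iff (l : Fin n) (φ : GA n K) :
    φ ∈ translationSubgroup K l ↔ ∃ c, φ.unop = translation l c := by
  constructor
  · rintro ⟨c, hc⟩
    refine ⟨c, ?_⟩
    apply AlgEquiv.coe_toAlgHom_injective
    apply MvPolynomial.algHom_ext
    intro i
    change φ.unop (X i) = translation l c (X i)
    rw [translation_X]
    exact hc i
  · rintro ⟨c, hc⟩
    refine ⟨c, fun i => ?_⟩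
    rw [← translation_X, ← hc]
    rfl

theorem exists_conj_translation [NeZero n] {ψ : GA n K} (hψ : ψ ∈ parabolicSubgroup n K) (c : K) :
    ∃ d, ψ.unop * translation (lastIndex n) c * ψ.unop⁻¹ = translation (lastIndex n) d := by
  -- `GA` is an opposite group, so conjugation by `ψ.unop` is conjugation by `ψ⁻¹` in `GA`.
  have h1 := Subgroup.mem_normalizer_iff.1 ((parabolicSubgroup n K).inv_mem hψ)
    (MulOpposite.op (translation (lastIndex n) c))
  have h2 := h1.1 ((mem_translationSubgroup_iff _ _).2 ⟨c, rfl⟩)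
  obtain ⟨d, hd⟩ := (mem_translationSubgroup_iff _ _).1 h2
  refine ⟨d, ?_⟩
  rw [← hd]
  simp [mul_assoc]

/-- With `E = φ ∂_l φ⁻¹`, the conjugated translations are the `exp(cE)`; the coefficient of `c` in
their components is `E (X i)`, which is therefore affine. -/
theorem isCoTame_of_conj_translation {l : Fin n} (hn : 3 ≤ n) {φ : GA n K} (hna : ¬ IsAffine φ)
    (h : ∀ c, IsAffineEquiv (φ.unop * translation l c * φ.unop⁻¹)) : IsCoTame φ := by
  rw [isAffine_iff] at hna
  have hH : ∀ σ, IsAffineEquiv σ →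
      σ ∈ (Subgroup.closure ({φ} ∪ {α | IsAffine α})).unop := fun σ hσ =>
    Subgroup.mem_unop.2 (Subgroup.subset_closure (Or.inr ((isAffine_iff _).2 hσ)))
  have hφ : φ.unop ∈ (Subgroup.closure ({φ} ∪ {α | IsAffine α})).unop :=
    Subgroup.mem_unop.2 (Subgroup.subset_closure (Or.inl rfl))
  refine (Subgroup.closure_le _).2 ?_
  rintro σ (hσ | hσ)
  · exact Subgroup.subset_closure (Or.inr hσ)
  · have hE := (isLocallyNilpotent_pderiv (K := K) l).conjDer φ.unop
    refine Subgroup.mem_unop.1 (triangular_mem_of_conj_pderiv_affine hn hH hφ hna (l := l)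
      (fun i => ?_) (σ := σ.unop) hσ)
    obtain ⟨M, hM⟩ := hE (X i)
    have hM' := iterate_zero_of_le hM (show M ≤ M + 2 by omega)
    have h1 := mem_of_forall_sum_pow_smul_mem (affinePolys n K) (N := M + 2)
      (a := fun j => ((j.factorial : K)⁻¹) •
        ((1 : MvPolynomial (Fin n) K) ^ j * (conjDer φ.unop (pderiv l))^[j] (X i))) (fun c _ => by
        rw [← expFun_const_smul c (Derivation.map_one_eq_zero _) hM']
        have h2 := h c i
        change φ.unop (expFun _ (φ.unop.symm (X i))) ∈ _ at h2
        rw [conj_expFun ((isLocallyNilpotent_pderiv l).smul_of_mem_ker (by simp)), conjDer_smul,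
          map_smul, map_one] at h2
        exact h2) (i := 1) (by omega)
    simpa using h1

/-- The difference of `f` and its translate has lower degree in `x_l`. -/
theorem iterate_pderiv_sub_translation {l : Fin n} {r : ℕ} {f : MvPolynomial (Fin n) K}
    (hf : (pderiv l)^[r + 1] f = 0) (d : K) :
    (pderiv l)^[r] (f - translation l d f) = 0 := by
  have h1 : f - translation l d f = ∑ i ∈ Finset.range r,
      (-(d ^ (i + 1) * ((i + 1).factorial : K)⁻¹)) • (pderiv l)^[i + 1] f := by
    rw [translation_apply, expFun_const_smul d (by simp) hf, Finset.sum_range_succ']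
    simp only [neg_smul, Finset.sum_neg_distrib, smul_smul, one_pow, one_mul]
    simp
  rw [h1, iterate_sum]
  refine Finset.sum_eq_zero fun i _ => ?_
  rw [iterate_smul, ← Function.iterate_add_apply, iterate_zero_of_le hf (by omega), smul_zero]

/-- Both parabolic factors are quantified inside the induction because the inductive step replaces
the pair `ψ₁, ψ₂` by `ψ₂⁻¹, ψ₂`. -/
theorem isAffine_or_isCoTame_of_commute [NeZero n] (hn : 3 ≤ n)
    {D : Derivation K (MvPolynomial (Fin n) K) (MvPolynomial (Fin n) K)}
    (hD : IsLocallyNilpotent D)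
    (hcomm : ∀ f, D (pderiv (lastIndex n) f) = pderiv (lastIndex n) (D f)) (r : ℕ) :
    ∀ (F : MvPolynomial (Fin n) K) (hF : D F = 0), (pderiv (lastIndex n))^[r] F = 0 →
      ∀ ψ₁ ∈ parabolicSubgroup n K, ∀ ψ₂ ∈ parabolicSubgroup n K,
        IsAffine (ψ₁ * expGA (F • D) (hD.smul_of_mem_ker hF) * ψ₂) ∨
        IsCoTame (ψ₁ * expGA (F • D) (hD.smul_of_mem_ker hF) * ψ₂) := by
  have hτD : ∀ (d : K) (f : MvPolynomial (Fin n) K),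
      translation (lastIndex n) d (D f) = D (translation (lastIndex n) d f) := by
    intro d f
    refine (map_expFun ((isLocallyNilpotent_pderiv (lastIndex n)).smul_of_mem_ker (by simp))
      D.toLinearMap (fun f => ?_) f).symm
    change D ((d • (1 : MvPolynomial (Fin n) K)) • pderiv (lastIndex n) f) =
      (d • (1 : MvPolynomial (Fin n) K)) • pderiv (lastIndex n) (D f)
    rw [smul_assoc, smul_assoc, one_smul, one_smul, Derivation.map_smul, hcomm]
  have hFD : ∀ (d : K) (F : MvPolynomial (Fin n) K), D F = 0 →
      D (F - translation (lastIndex n) d F) = 0 := by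
    intro d F hF
    rw [map_sub, ← hτD, hF, map_zero, sub_zero]
  have hconj : ∀ (F : MvPolynomial (Fin n) K) (hF : D F = 0),
      ∀ ψ₁ ∈ parabolicSubgroup n K, ∀ ψ₂ ∈ parabolicSubgroup n K, ∀ c : K, ∃ d d' : K,
      (ψ₁ * expGA (F • D) (hD.smul_of_mem_ker hF) * ψ₂).unop * translation (lastIndex n) c *
        (ψ₁ * expGA (F • D) (hD.smul_of_mem_ker hF) * ψ₂).unop⁻¹ =
      (ψ₂⁻¹ * expGA ((F - translation (lastIndex n) d F) • D)
        (hD.smul_of_mem_ker (hFD d F hF)) * ψ₂).unop * translation (lastIndex n) d' := by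
    intro F hF ψ₁ h₁ ψ₂ h₂ c
    obtain ⟨d, hd⟩ := exists_conj_translation h₁ c
    obtain ⟨d', hd'⟩ := exists_conj_translation h₂ d
    refine ⟨d, d', ?_⟩
    set τ := translation (lastIndex n) d with hτ
    -- As `τ` commutes with `D`, moving it past `exp(FD)` replaces `F` by `τ F`; the multipliers
    -- then add up to `F`.
    have hkey : expAlgEquiv (F • D) (hD.smul_of_mem_ker hF) * τ =
        expAlgEquiv ((F - τ F) • D) (hD.smul_of_mem_ker (hFD d F hF)) *
          (τ * expAlgEquiv (F • D) (hD.smul_of_mem_ker hF)) := by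
      refine AlgEquiv.ext fun f => ?_
      change expFun (F • D) (τ f) = expFun ((F - τ F) • D) (τ (expFun (F • D) f))
      have h1 := map_expFun (D' := τ F • D) (hD.smul_of_mem_ker hF) τ.toLinearMap (fun f => by
        change τ (F • D f) = τ F • D (τ f)
        rw [smul_eq_mul, map_mul, hτD, smul_eq_mul]) f
      change τ (expFun (F • D) f) = expFun (τ F • D) (τ f) at h1
      rw [h1, ← expFun_add_smul hD (hFD d F hF) (by rw [← hτD, hF, map_zero]), sub_add_cancel]
    have hkey' : expAlgEquiv (F • D) (hD.smul_of_mem_ker hF) * τ *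
        (expAlgEquiv (F • D) (hD.smul_of_mem_ker hF))⁻¹ =
        expAlgEquiv ((F - τ F) • D) (hD.smul_of_mem_ker (hFD d F hF)) * τ := by
      rw [hkey]
      group
    change ψ₂.unop * (expAlgEquiv (F • D) (hD.smul_of_mem_ker hF) * ψ₁.unop) *
      translation (lastIndex n) c *
      (ψ₂.unop * (expAlgEquiv (F • D) (hD.smul_of_mem_ker hF) * ψ₁.unop))⁻¹ =
      ψ₂.unop * (expAlgEquiv ((F - τ F) • D) (hD.smul_of_mem_ker (hFD d F hF)) * ψ₂.unop⁻¹) *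
        translation (lastIndex n) d'
    rw [← hd']
    calc _ = ψ₂.unop * (expAlgEquiv (F • D) (hD.smul_of_mem_ker hF) *
          (ψ₁.unop * translation (lastIndex n) c * ψ₁.unop⁻¹) *
          (expAlgEquiv (F • D) (hD.smul_of_mem_ker hF))⁻¹) * ψ₂.unop⁻¹ := by group
      _ = _ := by
        rw [hd, hkey']
        group
  have hstep : ∀ (F : MvPolynomial (Fin n) K) (hF : D F = 0),
      ∀ ψ₁ ∈ parabolicSubgroup n K, ∀ ψ₂ ∈ parabolicSubgroup n K,
      (∀ d : K, IsAffine (ψ₂⁻¹ * expGA ((F - translation (lastIndex n) d F) • D)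
          (hD.smul_of_mem_ker (hFD d F hF)) * ψ₂) ∨
        IsCoTame (ψ₂⁻¹ * expGA ((F - translation (lastIndex n) d F) • D)
          (hD.smul_of_mem_ker (hFD d F hF)) * ψ₂)) →
      IsAffine (ψ₁ * expGA (F • D) (hD.smul_of_mem_ker hF) * ψ₂) ∨
        IsCoTame (ψ₁ * expGA (F • D) (hD.smul_of_mem_ker hF) * ψ₂) := by
    intro F hF ψ₁ h₁ ψ₂ h₂ hall
    by_cases hna : IsAffine (ψ₁ * expGA (F • D) (hD.smul_of_mem_ker hF) * ψ₂)
    · exact Or.inl hna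
    refine Or.inr ?_
    set φ := ψ₁ * expGA (F • D) (hD.smul_of_mem_ker hF) * ψ₂ with hφ
    by_cases haff : ∀ c, IsAffineEquiv (φ.unop * translation (lastIndex n) c * φ.unop⁻¹)
    · exact isCoTame_of_conj_translation hn hna haff
    push Not at haff
    obtain ⟨c, hc⟩ := haff
    obtain ⟨d, d', hdd⟩ := hconj F hF ψ₁ h₁ ψ₂ h₂ c
    rw [← hφ] at hdd
    set φ' := ψ₂⁻¹ * expGA ((F - translation (lastIndex n) d F) • D)
      (hD.smul_of_mem_ker (hFD d F hF)) * ψ₂ with hφ'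
    rcases hall d with h | h
    · refine absurd ?_ hc
      rw [hdd]
      exact ((isAffine_iff _).1 h).mul (isAffineEquiv_translation _ _)
    · refine h.of_mem ?_
      have hτ : ∀ c, MulOpposite.op (translation (lastIndex n) c) ∈
          Subgroup.closure ({φ} ∪ {α | IsAffine α}) := fun c =>
        Subgroup.subset_closure (Or.inr ((isAffine_iff _).2 (isAffineEquiv_translation _ _)))
      have hφm : φ ∈ Subgroup.closure ({φ} ∪ {α | IsAffine α}) :=
        Subgroup.subset_closure (Or.inl rfl)
      have hEq : φ' = (MulOpposite.op (translation (lastIndex n) d'))⁻¹ *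
          (φ⁻¹ * MulOpposite.op (translation (lastIndex n) c) * φ) := by
        apply MulOpposite.unop_injective
        rw [eq_mul_inv_of_mul_eq hdd.symm]
        simp [mul_assoc]
      change φ' ∈ _
      rw [hEq]
      exact Subgroup.mul_mem _ (Subgroup.inv_mem _ (hτ d'))
        (Subgroup.mul_mem _ (Subgroup.mul_mem _ (Subgroup.inv_mem _ hφm) (hτ c)) hφm)
  induction r with
  | zero =>
    intro F hF h0 ψ₁ h₁ ψ₂ h₂
    -- Here `F = 0`, so the automorphism produced by the step is the identity.
    refine hstep F hF ψ₁ h₁ ψ₂ h₂ fun d => Or.inl ?_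
    have hF0 : F = 0 := h0
    subst hF0
    rw [isAffine_iff]
    intro i
    change ψ₂.unop (expFun _ (ψ₂.unop.symm (X i))) ∈ _
    rw [map_zero, sub_zero, zero_smul, expFun_zero, ψ₂.unop.apply_symm_apply]
    exact X_mem_affinePolys i
  | succ r ih =>
    intro F hF h0 ψ₁ h₁ ψ₂ h₂
    exact hstep F hF ψ₁ h₁ ψ₂ h₂ fun d =>
      ih _ (hFD d F hF) (iterate_pderiv_sub_translation h0 d) _ (Subgroup.inv_mem _ h₂) _ h₂

theorem isAffine_or_isCoTame [NeZero n] (hn : 3 ≤ n)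
    {D : Derivation K (MvPolynomial (Fin n) K) (MvPolynomial (Fin n) K)}
    (hD : IsLocallyNilpotent D) (hDt : IsTriangularDerivation D) {F : MvPolynomial (Fin n) K}
    (hF : D F = 0) {ψ₁ : GA n K} (h₁ : ψ₁ ∈ parabolicSubgroup n K) {ψ₂ : GA n K}
    (h₂ : ψ₂ ∈ parabolicSubgroup n K) :
    IsAffine (ψ₁ * expGA (F • D) (hD.smul_of_mem_ker hF) * ψ₂) ∨
      IsCoTame (ψ₁ * expGA (F • D) (hD.smul_of_mem_ker hF) * ψ₂) := by
  obtain ⟨r, hr⟩ := isLocallyNilpotent_pderiv (lastIndex n) F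
  exact isAffine_or_isCoTame_of_commute hn hD hDt.commute_pderiv r F hF hr ψ₁ h₁ ψ₂ h₂

theorem isAffine_or_isCoTame_expGA [NeZero n] (hn : 3 ≤ n)
    {D : Derivation K (MvPolynomial (Fin n) K) (MvPolynomial (Fin n) K)}
    (hD : IsLocallyNilpotent D) (hDt : IsTriangularDerivation D) {F : MvPolynomial (Fin n) K}
    (hF : D F = 0) : IsAffine (expGA (F • D) (hD.smul_of_mem_ker hF)) ∨
      IsCoTame (expGA (F • D) (hD.smul_of_mem_ker hF)) := by
  simpa only [one_mul, mul_one] using isAffine_or_isCoTame hn hD hDt hF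
    (Subgroup.one_mem _) (Subgroup.one_mem _)

end

end CoTame

theorem mainTheorem5 (K : Type*) [Field K] [CharZero K] :
    (∀ (n : ℕ) [NeZero n], 3 ≤ n →
      ∀ (D : Derivation K (MvPolynomial (Fin n) K) (MvPolynomial (Fin n) K))
        (hD : CoTame.IsLocallyNilpotent D), CoTame.IsTriangularDerivation D →
      ∀ (F : MvPolynomial (Fin n) K) (hF : D F = 0),
        (∀ ψ₁ ∈ CoTame.parabolicSubgroup n K, ∀ ψ₂ ∈ CoTame.parabolicSubgroup n K,
          CoTame.IsAffine (ψ₁ * CoTame.expGA (F • D) (hD.smul_of_mem_ker hF) * ψ₂) ∨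
          CoTame.IsCoTame (ψ₁ * CoTame.expGA (F • D) (hD.smul_of_mem_ker hF) * ψ₂)) ∧
        (CoTame.IsAffine (CoTame.expGA (F • D) (hD.smul_of_mem_ker hF)) ∨
          CoTame.IsCoTame (CoTame.expGA (F • D) (hD.smul_of_mem_ker hF)))) ∧
    (∃ (D : Derivation K (MvPolynomial (Fin 3) K) (MvPolynomial (Fin 3) K))
        (hD : CoTame.IsLocallyNilpotent D) (F : MvPolynomial (Fin 3) K) (hF : D F = 0),
      CoTame.IsTriangularDerivation D ∧
      (∀ i, (CoTame.expGA (F • D) (hD.smul_of_mem_ker hF)).component i =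
        CoTame.nagataComponents K i) ∧
      CoTame.IsCoTame (CoTame.expGA (F • D) (hD.smul_of_mem_ker hF))) := by
  refine ⟨fun n _ hn D hD hDt F hF => ⟨fun ψ₁ h₁ ψ₂ h₂ =>
    CoTame.isAffine_or_isCoTame hn hD hDt hF h₁ h₂,
    CoTame.isAffine_or_isCoTame_expGA hn hD hDt hF⟩,
    CoTame.nagataDerivation K, CoTame.isLocallyNilpotent_nagataDerivation, _,
    CoTame.nagataDerivation_apply_eq_zero, CoTame.isTriangularDerivation_nagataDerivation,
    CoTame.component_expGA_nagataDerivation, ?_⟩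
  exact (CoTame.isAffine_or_isCoTame_expGA le_rfl CoTame.isLocallyNilpotent_nagataDerivation
    CoTame.isTriangularDerivation_nagataDerivation
    CoTame.nagataDerivation_apply_eq_zero).resolve_left
    (CoTame.not_isAffine_of_component_eq_nagataComponents
      CoTame.component_expGA_nagataDerivation)
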